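/- Let $K$ be a field and let $(E,w)$ be a finite weighted graph with at least one vertex: $E=(E^0,E^1,s,r)$ is a directed graph with $E^0\neq\emptyset$ and $E^1$ finite sets, and $w:E^1\to\{1,2,\dots\}$. A vertex $v$ is regular if $s^{-1}(v)\neq\emptyset$, and then $w(v):=\max\{w(e)\mid e\in s^{-1}(v)\}$. Let $\hat E$ be the directed graph with vertex set $E^0$ and edges $e_1,\dots,e_{w(e)}$ from $s(e)$ to $r(e)$ for each $e\in E^1$, and let $\hat E_d$ be its double graph, obtained by adding for each edge $e_i$ a ghost edge $e_i^*$ from $r(e)$ to $s(e)$. The weighted Leavitt path algebra $L_K(E,w)$ is the (not necessarily unital) associative $K$-algebra generated by the vertices and edges of $\hat E_d$ subject to the relations $uv=\delta_{uv}u$ for vertices $u,v$; $s(x)x=x=x\,r(x)$ for edges $x$ of $\hat E_d$; and, for each regular vertex $v$, \[\sum_{e\in s^{-1}(v)}e_ie_j^*=\delta_{ij}v\quad(1\le i,j\le w(v)),\qquad \sum_{1\le i\le w(v)}e_i^*f_i=\delta_{ef}\,r(e)\quad(e,f\in s^{-1}(v)),\] where $e_i$ and $e_i^*$ are read as $0$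 if $i>w(e)$. Fix for every regular vertex $v$ an edge $e^v\in s^{-1}(v)$ with $w(e^v)=w(v)$. The words $e^v_i(e^v_j)^*$ ($1\le i,j\le w(v)$) and $e_1^*f_1$ ($e,f\in s^{-1}(v)$), for $v$ regular, are called forbidden. A path in $\hat E_d$ is either a single vertex (length $0$) or a nonempty word of composable edges of $\hat E_d$; a nod-path is a path in $\hat E_d$ without forbidden subwords (subwords are contiguous). For nod-paths $p,q$ write $p\overset{\mathrm{nod}}{\Longrightarrow}q$ if there is a nod-path $o$ such that $p$ is not a prefix of $o$ and the word $poq$ is a nod-path, and write $p\Longrightarrow q$ if the word $pq$ is a nod-path or $p\overset{\mathrm{nod}}{\Longrightarrow}q$. A nod$^2$-path is a nod-path $p$ such that the word $p^2$ is a nod-path. A quasi-cycle is a nod$^2$-path $p$ such that no subword of $p^2$ of length less than $|p|$ is a nod$^2$-path; it is selfconnected if $p\overset{\mathrm{nod}}{\Longrightarrow}p$. Two quasi-cycles are equivalent, $p\approx q$, if $q$ is a cyclic rotation of the word $p$. A chain of length $k\ge 0$ is a sequence $p_1,\dots,p_k$ of pairwise non-equivalent quasi-cycles with $p_1\Longrightarrow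 p_2\Longrightarrow\dots\Longrightarrow p_k$. For a $K$-algebra $A$ with a finite-dimensional generating subspace $V$, let $V^n$ be the span of all products of $k$ elements of $V$, $1\le k\le n$, and $d_V(n)=\dim_K V^n$. $A$ has polynomial growth if for some positive integers $m$ and $c$ one has $d_V(n)\le c(cn)^m$ for all $n\ge1$, and $\operatorname{GKdim}A=\limsup_{n\to\infty}\log_n d_V(n)$; neither notion depends on the choice of $V$. Then: (i) $L_K(E,w)$ has polynomial growth if and only if there is no selfconnected quasi-cycle. (ii) If $L_K(E,w)$ has polynomial growth, then the chains of quasi-cycles have a maximal length $d$, and $\operatorname{GKdim}L_K(E,w)=d$. -/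

import Mathlib

/-! ### Directed graphs, double graphs, paths -/

/-- A directed graph with vertex set `V` and edge set `E`. -/
structure DirGraph (V E : Type*) where
  src : E → V
  rng : E → V

namespace DirGraph

variable {V E : Type*}

/-- The double graph: `Sum.inl e` is the real edge `e`, `Sum.inr e` is the ghost edge `e*`. -/
def double (G : DirGraph V E) : DirGraph V (E ⊕ E) where
  src := Sum.elim G.src G.rng
  rng := Sum.elim G.rng G.src

/-- A path is a word over the alphabet `V ⊕ E` that is either a single vertex or a nonempty word
of composable edges. -/
def IsPath (G : DirGraph V E) (p : List (V ⊕ E)) : Prop :=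
  (∃ v : V, p = [Sum.inl v]) ∨
    ∃ l : List E, l ≠ [] ∧ l.IsChain (fun x y => G.rng x = G.src y) ∧ p = l.map Sum.inr

end DirGraph

/-- The length of a path: the number of its edges (so a vertex has length `0`). -/
def pathLength {V E : Type*} (p : List (V ⊕ E)) : ℕ := p.countP Sum.isRight

/-! ### Quotients of (not necessarily unital) algebras by relations -/

section Quotient

variable (K : Type*) {A : Type*} [CommRing K] [NonUnitalRing A] [Module K A]

/-- The congruence on the (not necessarily unital) `K`-algebra `A` generated by the relations
`a = b` for `r a b`; it is closed under scalars because all scalar multiples of the relations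
are included. -/
def algConGen (r : A → A → Prop) : RingCon A :=
  ringConGen fun x y => ∃ (k : K) (a b : A), r a b ∧ x = k • a ∧ y = k • b

theorem algConGen_smul [IsScalarTower K A A] (r : A → A → Prop) (k : K) {x y : A} (h : algConGen K r x y) :
    algConGen K r (k • x) (k • y) := by
  change RingConGen.Rel _ x y at h
  change RingConGen.Rel _ (k • x) (k • y)
  induction h with
  | of x y h =>
    obtain ⟨c, a, b, hr, rfl, rfl⟩ := h
    exact .of _ _ ⟨k * c, a, b, hr, (mul_smul k c a).symm, (mul_smul k c b).symm⟩
  | refl x => exact .refl _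
  | symm _ ih => exact .symm ih
  | trans _ _ ih₁ ih₂ => exact .trans ih₁ ih₂
  | add _ _ ih₁ ih₂ => rw [smul_add, smul_add]; exact .add ih₁ ih₂
  | mul _ h₂ ih₁ _ => rw [← smul_mul_assoc, ← smul_mul_assoc]; exact .mul ih₁ h₂

/-- The quotient of the `K`-algebra `A` by the ideal generated by the relations `r`. -/
def AlgQuot (r : A → A → Prop) : Type _ := (algConGen K r).Quotient

namespace AlgQuot

variable (r : A → A → Prop)

instance : NonUnitalRing (AlgQuot K r) := inferInstanceAs (NonUnitalRing (algConGen K r).Quotient)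

/-- The quotient map. -/
def mk (a : A) : AlgQuot K r := RingCon.toQuotient (c := algConGen K r) a

theorem mk_surjective : Function.Surjective (mk K r) := Quotient.mk''_surjective

/-- The quotient map as a homomorphism of additive groups. -/
def mkAddHom : A →+ AlgQuot K r where
  toFun := mk K r
  map_zero' := rfl
  map_add' _ _ := rfl

variable [IsScalarTower K A A]

instance : SMul K (AlgQuot K r) where
  smul k := Quotient.map' (k • ·) fun _ _ h => algConGen_smul K r k h

instance : Module K (AlgQuot K r) :=
  Function.Surjective.module K (mkAddHom K r) (mk_surjective K r) fun _ _ => rfl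

instance : IsScalarTower K (AlgQuot K r) (AlgQuot K r) where
  smul_assoc k x y := by
    obtain ⟨a, rfl⟩ := mk_surjective K r x
    obtain ⟨b, rfl⟩ := mk_surjective K r y
    exact congrArg (mk K r) (smul_mul_assoc k a b)

instance [SMulCommClass K A A] : SMulCommClass K (AlgQuot K r) (AlgQuot K r) where
  smul_comm k x y := by
    obtain ⟨a, rfl⟩ := mk_surjective K r x
    obtain ⟨b, rfl⟩ := mk_surjective K r y
    exact congrArg (mk K r) (mul_smul_comm k a b).symm

end AlgQuot

end Quotient

/-- The free (not necessarily unital) associative `K`-algebra on `X`. -/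
abbrev FreeNUAlgebra (K X : Type*) [CommRing K] : Type _ := MonoidAlgebra K (FreeSemigroup X)

/-- The generator of the free algebra that corresponds to `x`. -/
noncomputable def FreeNUAlgebra.gen (K : Type*) {X : Type*} [CommRing K] (x : X) :
    FreeNUAlgebra K X :=
  MonoidAlgebra.single (FreeSemigroup.of x) 1

open Classical in
/-- The defining relations of the path algebra of a directed graph. -/
inductive DirGraph.PathAlgRel (K : Type*) [CommRing K] {V E : Type*} (G : DirGraph V E) :
    FreeNUAlgebra K (V ⊕ E) → FreeNUAlgebra K (V ⊕ E) → Prop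
  | vertex (u v : V) : PathAlgRel K G
      (FreeNUAlgebra.gen K (Sum.inl u) * FreeNUAlgebra.gen K (Sum.inl v))
      (if u = v then FreeNUAlgebra.gen K (Sum.inl u) else 0)
  | src (e : E) : PathAlgRel K G
      (FreeNUAlgebra.gen K (Sum.inl (G.src e)) * FreeNUAlgebra.gen K (Sum.inr e))
      (FreeNUAlgebra.gen K (Sum.inr e))
  | rng (e : E) : PathAlgRel K G
      (FreeNUAlgebra.gen K (Sum.inr e) * FreeNUAlgebra.gen K (Sum.inl (G.rng e)))
      (FreeNUAlgebra.gen K (Sum.inr e))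

/-! ### Weighted graphs and weighted Leavitt path algebras -/

/-- A weighted graph: a directed graph with a positive integer weight on each edge. -/
structure WeightedGraph (V E : Type*) extends DirGraph V E where
  weight : E → ℕ
  weight_pos : ∀ e, 0 < weight e

namespace WeightedGraph

variable {V E : Type*}

/-- The edges `e_1, …, e_{w(e)}` of the associated directed graph; the edge `e_i` is
`⟨e, i - 1⟩`, i.e. indices are shifted to start at `0`. -/
abbrev HatEdge (G : WeightedGraph V E) : Type _ := Σ e : E, Fin (G.weight e)

/-- The directed graph associated to a weighted graph. -/
def hat (G : WeightedGraph V E) : DirGraph V G.HatEdge where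
  src x := G.src x.1
  rng x := G.rng x.1

/-- The real (`Sum.inl`) and ghost (`Sum.inr`) edges of the double graph of `G.hat`. -/
abbrev DEdge (G : WeightedGraph V E) : Type _ := G.HatEdge ⊕ G.HatEdge

/-- The alphabet of vertices, real edges and ghost edges. -/
abbrev Letter (G : WeightedGraph V E) : Type _ := V ⊕ G.DEdge

/-- A vertex is regular if it emits an edge. -/
def IsRegular (G : WeightedGraph V E) (v : V) : Prop := ∃ e, G.src e = v

open Classical in
/-- The finite set of edges emitted by `v`. -/
noncomputable def emitted [Fintype E] (G : WeightedGraph V E) (v : V) : Finset E :=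
  Finset.univ.filter fun e => G.src e = v

/-- The weight of a vertex: the maximal weight of an edge that it emits. -/
noncomputable def vertexWeight [Fintype E] (G : WeightedGraph V E) (v : V) : ℕ :=
  (G.emitted v).sup G.weight

section Algebra

variable (K : Type*) [CommRing K] (G : WeightedGraph V E)

/-- The real edge `e_{i+1}` in the free algebra, `0` if `i + 1 > w(e)`. -/
noncomputable def realElt (e : E) (i : ℕ) : FreeNUAlgebra K G.Letter :=
  if h : i < G.weight e then FreeNUAlgebra.gen K (Sum.inr (Sum.inl ⟨e, i, h⟩)) else 0

/-- The ghost edge `e_{i+1}*` in the free algebra, `0` if `i + 1 > w(e)`. -/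
noncomputable def ghostElt (e : E) (i : ℕ) : FreeNUAlgebra K G.Letter :=
  if h : i < G.weight e then FreeNUAlgebra.gen K (Sum.inr (Sum.inr ⟨e, i, h⟩)) else 0

open Classical in
/-- The defining relations of the weighted Leavitt path algebra, on top of those of the path
algebra of the double graph of `G.hat`. -/
inductive LeavittRel [Fintype E] :
    FreeNUAlgebra K G.Letter → FreeNUAlgebra K G.Letter → Prop
  | path {a b : FreeNUAlgebra K G.Letter} (h : G.hat.double.PathAlgRel K a b) : LeavittRel a b
  | real_ghost (v : V) (hv : G.IsRegular v) (i j : ℕ)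
      (hi : i < G.vertexWeight v) (hj : j < G.vertexWeight v) :
      LeavittRel (∑ e ∈ G.emitted v, G.realElt K e i * G.ghostElt K e j)
        (if i = j then FreeNUAlgebra.gen K (Sum.inl v) else 0)
  | ghost_real (v : V) (hv : G.IsRegular v) (e f : E) (he : G.src e = v) (hf : G.src f = v) :
      LeavittRel (∑ i ∈ Finset.range (G.vertexWeight v), G.ghostElt K e i * G.realElt K f i)
        (if e = f then FreeNUAlgebra.gen K (Sum.inl (G.rng e)) else 0)

/-- The weighted Leavitt path algebra `L_K(E,w)`, as a not necessarily unital `K`-algebra. -/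
abbrev LeavittPathAlgebra [Fintype E] : Type _ := AlgQuot K (G.LeavittRel K)

end Algebra

/-! ### Nod-paths and quasi-cycles -/

/-- A choice of an edge `e^v` of maximal weight emitted by `v`, for every regular vertex `v`. -/
structure SpecialEdges [Fintype E] (G : WeightedGraph V E) where
  edge : ∀ v, G.IsRegular v → E
  src_edge : ∀ v hv, G.src (edge v hv) = v
  weight_edge : ∀ v hv, G.weight (edge v hv) = G.vertexWeight v

variable [Fintype E] {G : WeightedGraph V E} (c : G.SpecialEdges)

/-- The forbidden words `e^v_i (e^v_j)*` and `e_1* f_1` with `e`, `f` emitted by one vertex. -/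
inductive Forbidden : List G.Letter → Prop
  | real_ghost (v : V) (hv : G.IsRegular v) (i j : Fin (G.weight (c.edge v hv))) :
      Forbidden [Sum.inr (Sum.inl ⟨c.edge v hv, i⟩), Sum.inr (Sum.inr ⟨c.edge v hv, j⟩)]
  | ghost_real (e f : E) (h : G.src e = G.src f) :
      Forbidden [Sum.inr (Sum.inr ⟨e, 0, G.weight_pos e⟩),
        Sum.inr (Sum.inl ⟨f, 0, G.weight_pos f⟩)]

/-- A nod-path: a path in the double graph of `G.hat` without forbidden subwords. -/
def IsNodPath (p : List G.Letter) : Prop :=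
  G.hat.double.IsPath p ∧ ∀ q, q <:+: p → ¬ Forbidden c q

/-- `p ⟹ q` through a nod-path `o` that does not have `p` as a prefix. -/
def NodConnects (p q : List G.Letter) : Prop :=
  ∃ o, IsNodPath c o ∧ ¬ p <+: o ∧ IsNodPath c (p ++ o ++ q)

/-- The relation `p ⟹ q`. -/
def Connects (p q : List G.Letter) : Prop :=
  IsNodPath c (p ++ q) ∨ NodConnects c p q

/-- A nod²-path: a nod-path whose square is a nod-path. -/
def IsNodSqPath (p : List G.Letter) : Prop :=
  IsNodPath c p ∧ IsNodPath c (p ++ p)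

/-- A quasi-cycle: a nod²-path `p` such that no subword of `p²` shorter than `p` is a
nod²-path. -/
def IsQuasiCycle (p : List G.Letter) : Prop :=
  IsNodSqPath c p ∧ ∀ q, q <:+: p ++ p → pathLength q < pathLength p → ¬ IsNodSqPath c q

/-- A selfconnected quasi-cycle. -/
def IsSelfconnected (p : List G.Letter) : Prop :=
  IsQuasiCycle c p ∧ NodConnects c p p

/-- A chain of quasi-cycles: consecutive members are related by `⟹`, and no two members are
cyclic rotations of each other. -/
def IsQuasiCycleChain (L : List (List G.Letter)) : Prop :=
  (∀ p ∈ L, IsQuasiCycle c p) ∧ L.Pairwise (fun p q => ¬ p.IsRotated q) ∧ L.IsChain (Connects c)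

end WeightedGraph

/-! ### Growth of algebras -/

section Growth

variable {K A : Type*} [Field K] [NonUnitalRing A] [Module K A]

/-- `V^n`: the span of all products of `k` elements of `V`, `1 ≤ k ≤ n`. -/
def growthSpace (V : Submodule K A) (n : ℕ) : Submodule K A :=
  Submodule.span K {a | ∃ v ∈ V, ∃ l : List A, (∀ x ∈ l, x ∈ V) ∧ l.length + 1 ≤ n ∧
    a = l.foldl (· * ·) v}

/-- `V` is a finite-dimensional subspace that generates the algebra. -/
def IsGeneratingSpace (V : Submodule K A) : Prop :=
  FiniteDimensional K V ∧ ∀ a : A, ∃ n, a ∈ growthSpace V n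

/-- `d_V(n) = dim V^n`. -/
noncomputable def growthFun (V : Submodule K A) (n : ℕ) : ℕ := Module.finrank K (growthSpace V n)

/-- `f ≼ g`: there is a positive integer `c` with `f(n) ≤ c g(cn)` for all `n ≥ 1`. -/
def AsympLE (f g : ℕ → ℝ) : Prop := ∃ c : ℕ, 1 ≤ c ∧ ∀ n, 1 ≤ n → f n ≤ c * g (c * n)

variable (K A)

/-- The algebra is finitely generated with `d_V ≼ n^m` for some `m`. -/
def HasPolynomialGrowth : Prop :=
  ∃ V : Submodule K A, IsGeneratingSpace V ∧
    ∃ m : ℕ, 1 ≤ m ∧ AsympLE (fun n => growthFun V n) (fun n => (n : ℝ) ^ m)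

/-- `GKdim A = d`: the algebra is finitely generated and `limsup log_n (dim V^n) = d` for every
finite-dimensional generating subspace `V`. -/
def IsGKDim (d : EReal) : Prop :=
  (∃ V : Submodule K A, IsGeneratingSpace V) ∧
    ∀ V : Submodule K A, IsGeneratingSpace V →
      Filter.limsup (fun n : ℕ => (Real.logb n (growthFun V n) : EReal)) Filter.atTop = d

end Growth

/-!
The second family of relations says that for each regular vertex `v` the matrix `X` with entries
`e_i` (rows `i`, columns `e`) makes `X X*` and `X* X` diagonal with vertices on the diagonal.
Solving each relation for the product through a pivot, the column `e^v` in `X X*` and the row `1`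
in `X* X`, rewrites forbidden words without lengthening them, so the nod-paths of length at most
`n` span `V^n` if `V` is spanned by the vertices and edges. Letting the generators act on the
space with basis the nod-paths by this rewriting shows that they are linearly independent. So
`dim V^n` is, up to a constant factor, the number of walks with at most `n` vertices in the
relation "may follow in a nod-path" on the edges of the double graph.

The rest is about the walks of a relation on a finite set. A selfconnected quasi-cycle gives two
closed walks at the same vertex whose iterates can be mixed freely, hence exponential growth.
Without one, every strongly connected component is a single cycle, which is a quasi-cycle up to
rotation, so a walk runs through a chain of quasi-cycles and is determined, up to finitely many
choices, by the time it spends on each. The number of walks then has degree the maximal length of a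
chain.
-/

/-! ### Growth functions -/

section Growth

variable {K A : Type*} [Field K] [NonUnitalRing A] [Module K A]

theorem growthSpace_mono (V : Submodule K A) : Monotone (growthSpace V) := by
  refine fun m n h => Submodule.span_mono ?_
  rintro a ⟨v, hv, l, hl, hlen, rfl⟩
  exact ⟨v, hv, l, hl, hlen.trans h, rfl⟩

theorem le_growthSpace (V : Submodule K A) {n : ℕ} (hn : 1 ≤ n) : V ≤ growthSpace V n :=
  fun v hv => Submodule.subset_span ⟨v, hv, [], by simp, hn, rfl⟩

theorem growthSpace_zero (V : Submodule K A) : growthSpace V 0 = ⊥ := by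
  refine Submodule.span_eq_bot.2 ?_
  rintro a ⟨v, -, l, -, hlen, -⟩
  omega

theorem growthSpace_le {V : Submodule K A} {F : ℕ → Submodule K A} (hF : Monotone F)
    (hone : V ≤ F 1) (hmul : ∀ n, ∀ a ∈ F n, ∀ b ∈ V, a * b ∈ F (n + 1)) (n : ℕ) :
    growthSpace V n ≤ F n := by
  refine Submodule.span_le.2 ?_
  rintro a ⟨v, hv, l, hl, hlen, rfl⟩
  refine hF hlen ?_
  clear hlen
  induction l using List.reverseRecOn with
  | nil => exact hone hv
  | append_singleton l x ih =>
    rw [List.foldl_append, List.length_append]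
    exact hmul _ _ (ih fun y hy => hl y (List.mem_append_left _ hy)) _ (hl x (by simp))

theorem IsGeneratingSpace.exists_le_growthSpace {V : Submodule K A} (hV : IsGeneratingSpace V)
    (W : Submodule K A) [FiniteDimensional K W] : ∃ c, 1 ≤ c ∧ W ≤ growthSpace V c := by
  obtain ⟨S, rfl⟩ := (Module.Finite.iff_fg (N := W)).1 inferInstance
  choose f hf using hV.2
  refine ⟨S.sup f + 1, by omega, Submodule.span_le.2 fun a ha => ?_⟩
  exact growthSpace_mono V ((Finset.le_sup ha).trans (Nat.le_succ _)) (hf a)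

theorem hasPolynomialGrowth_of_growthFun_le {V : Submodule K A} (hV : IsGeneratingSpace V)
    {B d : ℕ} (h : ∀ n, 1 ≤ n → growthFun V n ≤ B * n ^ d) : HasPolynomialGrowth K A := by
  refine ⟨V, hV, d + 1, by omega, B + 1, by omega, fun n hn => ?_⟩
  have hle : growthFun V n ≤ (B + 1) * ((B + 1) * n) ^ (d + 1) :=
    calc growthFun V n ≤ B * n ^ d := h n hn
      _ ≤ (B + 1) * ((B + 1) * n) ^ d := by gcongr <;> nlinarith
      _ ≤ (B + 1) * ((B + 1) * n) ^ (d + 1) := by gcongr <;> nlinarith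
  dsimp only
  exact_mod_cast hle

variable [IsScalarTower K A A] [SMulCommClass K A A]

theorem growthSpace_succ_le (V : Submodule K A) (n : ℕ) :
    growthSpace V (n + 1) ≤ V ⊔ Submodule.map₂ (LinearMap.mul K A) (growthSpace V n) V := by
  refine Submodule.span_le.2 ?_
  rintro a ⟨v, hv, l, hl, hlen, rfl⟩
  rcases List.eq_nil_or_concat' l with rfl | ⟨l, x, rfl⟩
  · exact Submodule.mem_sup_left hv
  · rw [List.foldl_append]
    refine Submodule.mem_sup_right (Submodule.apply_mem_map₂ _ ?_ (hl x (by simp)))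
    refine Submodule.subset_span ⟨v, hv, l, fun y hy => hl y (List.mem_append_left _ hy), ?_, rfl⟩
    simpa using hlen

instance finiteDimensional_growthSpace (V : Submodule K A) [hV : FiniteDimensional K V] (n : ℕ) :
    FiniteDimensional K (growthSpace V n) := by
  induction n with
  | zero => rw [growthSpace_zero]; infer_instance
  | succ n ih =>
    rw [FiniteDimensional, Module.Finite.iff_fg] at hV ih
    have hfg := hV.sup (ih.map₂ (LinearMap.mul K A) hV)
    have := Module.Finite.iff_fg.2 hfg
    exact Submodule.finiteDimensional_of_le (growthSpace_succ_le V n)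

theorem mul_mem_growthSpace {V : Submodule K A} {m n : ℕ} {a b : A} (ha : a ∈ growthSpace V m)
    (hb : b ∈ growthSpace V n) : a * b ∈ growthSpace V (m + n) := by
  suffices h : Submodule.map₂ (LinearMap.mul K A) (growthSpace V m) (growthSpace V n) ≤
      growthSpace V (m + n) from h (Submodule.apply_mem_map₂ _ ha hb)
  rw [growthSpace, growthSpace, Submodule.map₂_span_span, Submodule.span_le]
  rintro _ ⟨_, ⟨v, hv, l, hl, hlen, rfl⟩, _, ⟨v', hv', l', hl', hlen', rfl⟩, rfl⟩
  refine Submodule.subset_span ⟨v, hv, l ++ v' :: l', ?_, ?_, ?_⟩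
  · simp only [List.forall_mem_append, List.forall_mem_cons]
    exact ⟨hl, hv', hl'⟩
  · rw [List.length_append, List.length_cons]
    omega
  · rw [List.foldl_append, List.foldl_cons, List.foldl_assoc]
    rfl

theorem growthSpace_le_growthSpace_mul {V W : Submodule K A} {c : ℕ}
    (h : W ≤ growthSpace V c) (n : ℕ) : growthSpace W n ≤ growthSpace V (c * n) := by
  refine growthSpace_le (F := fun n => growthSpace V (c * n))
    ((growthSpace_mono V).comp fun m n hmn => Nat.mul_le_mul_left c hmn) (by simpa using h) ?_ n
  intro n a ha b hb
  rw [Nat.mul_succ]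
  exact mul_mem_growthSpace ha (h hb)

theorem growthFun_mono (V : Submodule K A) [FiniteDimensional K V] : Monotone (growthFun V) :=
  fun _ _ h => Submodule.finrank_mono (growthSpace_mono V h)

theorem IsGeneratingSpace.exists_growthFun_le {V : Submodule K A} (hV : IsGeneratingSpace V)
    (W : Submodule K A) [FiniteDimensional K W] :
    ∃ c, 1 ≤ c ∧ ∀ n, growthFun W n ≤ growthFun V (c * n) := by
  have := hV.1
  obtain ⟨c, hc, hW⟩ := hV.exists_le_growthSpace W
  exact ⟨c, hc, fun n => Submodule.finrank_mono (growthSpace_le_growthSpace_mul hW n)⟩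

theorem HasPolynomialGrowth.exists_growthFun_le (h : HasPolynomialGrowth K A)
    (W : Submodule K A) [FiniteDimensional K W] :
    ∃ C m : ℕ, ∀ n, 1 ≤ n → growthFun W n ≤ C * n ^ m := by
  obtain ⟨V, hV, m, -, a, -, ha⟩ := h
  obtain ⟨b, hb, hW⟩ := hV.exists_growthFun_le W
  refine ⟨a * (a * b) ^ m, m, fun n hn => (hW n).trans ?_⟩
  have hV_le : (growthFun V (b * n) : ℝ) ≤ a * ((a * (b * n) : ℕ) : ℝ) ^ m :=
    ha _ (Nat.mul_pos hb hn)
  rw [mul_assoc, ← mul_pow, mul_assoc]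
  exact_mod_cast hV_le

theorem not_forall_two_pow_le (C m : ℕ) : ¬ ∀ n : ℕ, 2 ^ n ≤ C * (n + 1) ^ m := by
  intro h
  have hlim := (tendsto_pow_const_div_const_pow_of_one_lt m (one_lt_two (α := ℝ))).const_mul
    (2 * C : ℝ)
  rw [mul_zero] at hlim
  have hge : ∀ᶠ n : ℕ in Filter.atTop, (1 : ℝ) ≤ 2 * C * ((n : ℝ) ^ m / 2 ^ n) := by
    filter_upwards [Filter.eventually_ge_atTop 1] with n hn
    obtain ⟨k, rfl⟩ := Nat.exists_eq_add_of_le' hn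
    have hk : (2 : ℝ) ^ k ≤ C * (k + 1) ^ m := by exact_mod_cast h k
    rw [← mul_div_assoc, le_div_iff₀ (by positivity), pow_succ]
    push_cast
    linarith
  exact absurd (ge_of_tendsto hlim hge) (by norm_num)

theorem not_hasPolynomialGrowth_of_two_pow_le {V : Submodule K A} [FiniteDimensional K V] {M : ℕ}
    (hM : 1 ≤ M) (h : ∀ n, 2 ^ n ≤ growthFun V (M * (n + 1))) : ¬ HasPolynomialGrowth K A := by
  intro hpoly
  obtain ⟨C, m, hC⟩ := hpoly.exists_growthFun_le V
  refine not_forall_two_pow_le (C * M ^ m) m fun n => (h n).trans ?_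
  rw [mul_assoc, ← mul_pow]
  exact hC _ (Nat.mul_pos hM n.succ_pos)

end Growth

section LimsupLogb

open Filter Topology

theorem tendsto_logb_natCast_atTop (x : ℝ) :
    Tendsto (fun n : ℕ => Real.logb n x) atTop (𝓝 0) :=
  (Real.tendsto_log_atTop.comp tendsto_natCast_atTop_atTop).const_div_atTop (Real.log x)

theorem limsup_logb_eq_of_pow_bounds {f : ℕ → ℕ} {d : ℕ} {A B : ℝ} (hA : 0 < A) (hB : 0 < B)
    (hlow : ∀ᶠ n : ℕ in atTop, (n : ℝ) ^ d ≤ A * f n)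
    (hup : ∀ᶠ n : ℕ in atTop, (f n : ℝ) ≤ B * (n : ℝ) ^ d) :
    limsup (fun n : ℕ => (Real.logb n (f n) : EReal)) atTop = (d : EReal) := by
  have hpos : ∀ᶠ n : ℕ in atTop, (1 : ℝ) < n ∧ 0 < (n : ℝ) ^ d ∧ 0 < (f n : ℝ) := by
    filter_upwards [hlow, eventually_ge_atTop 2] with n hn hn2
    have hpow : 0 < (n : ℝ) ^ d := by positivity
    exact ⟨by exact_mod_cast hn2, hpow, pos_of_mul_pos_right (hpow.trans_le hn) hA.le⟩
  have hlim : Tendsto (fun n : ℕ => Real.logb n (f n)) atTop (𝓝 (d : ℝ)) := by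
    refine tendsto_of_tendsto_of_tendsto_of_le_of_le'
      (by simpa using (tendsto_logb_natCast_atTop A).const_sub (d : ℝ))
      (by simpa using (tendsto_logb_natCast_atTop B).add_const (d : ℝ)) ?_ ?_
    · filter_upwards [hlow, hpos] with n hn ⟨hn1, hpow, hf⟩
      have hlog := Real.logb_le_logb_of_le hn1 hpow hn
      rw [Real.logb_pow, Real.logb_self_eq_one hn1, mul_one, Real.logb_mul hA.ne' hf.ne'] at hlog
      linarith
    · filter_upwards [hup, hpos] with n hn ⟨hn1, hpow, hf⟩
      have hlog := Real.logb_le_logb_of_le hn1 hf hn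
      rwa [Real.logb_mul hB.ne' hpow.ne', Real.logb_pow, Real.logb_self_eq_one hn1,
        mul_one] at hlog
  have hlim' := ((continuous_coe_real_ereal.tendsto (d : ℝ)).comp hlim).limsup_eq
  rwa [EReal.coe_natCast] at hlim'

end LimsupLogb

theorem pow_le_mul_of_forall_pow_le {f : ℕ → ℕ} (hf : Monotone f) {q d : ℕ} (hq : 1 ≤ q)
    (h : ∀ m, 1 ≤ m → m ^ d ≤ f (q * m)) {n : ℕ} (hn : q ≤ n) :
    n ^ d ≤ (2 * q) ^ d * f n := by
  have hdiv : 1 ≤ n / q := (Nat.one_le_div_iff hq).2 hn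
  have hn_le : n ≤ 2 * q * (n / q) := by
    have hlt := Nat.lt_mul_div_succ n hq
    nlinarith
  calc n ^ d ≤ (2 * q) ^ d * (n / q) ^ d := by rw [← mul_pow]; gcongr
    _ ≤ (2 * q) ^ d * f n := by
      gcongr
      exact (h _ hdiv).trans (hf (Nat.mul_div_le n q))

theorem isGKDim_of_growthFun_bounds {K A : Type*} [Field K] [NonUnitalRing A] [Module K A]
    [IsScalarTower K A A] [SMulCommClass K A A] {V : Submodule K A} (hV : IsGeneratingSpace V)
    {a b d : ℕ} (ha : 1 ≤ a) (hb : 1 ≤ b) (hlow : ∀ m, 1 ≤ m → m ^ d ≤ growthFun V (a * m))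
    (hup : ∀ n, 1 ≤ n → growthFun V n ≤ b * n ^ d) : IsGKDim K A d := by
  refine ⟨⟨V, hV⟩, fun W hW => ?_⟩
  have := hV.1
  have := hW.1
  obtain ⟨p, hp, hWV⟩ := hV.exists_growthFun_le W
  obtain ⟨q, hq, hVW⟩ := hW.exists_growthFun_le V
  refine limsup_logb_eq_of_pow_bounds (A := ((2 * (q * a)) ^ d : ℕ)) (B := (b * p ^ d : ℕ))
    (by positivity) (by positivity) ?_ ?_
  · filter_upwards [Filter.eventually_ge_atTop (q * a)] with n hn
    exact_mod_cast pow_le_mul_of_forall_pow_le (growthFun_mono W) (Nat.mul_pos hq ha)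
      (fun m hm => (hlow m hm).trans (by rw [mul_assoc]; exact hVW (a * m))) hn
  · filter_upwards [Filter.eventually_ge_atTop 1] with n hn
    have hW_le : growthFun W n ≤ b * p ^ d * n ^ d := by
      rw [mul_assoc, ← mul_pow]
      exact (hWV n).trans (hup _ (Nat.mul_pos hp hn))
    exact_mod_cast hW_le

/-! ### Closed walks of a relation -/

namespace RelWalk

open Relation

variable {D : Type*} (R : D → D → Prop)

/-- A closed walk of `R`, given by the word of its vertices without the repeated base point: it is
nonempty and may be followed by itself. -/
def IsClosed (p : List D) : Prop := p ≠ [] ∧ (p ++ p).IsChain R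

/-- A closed walk whose square has no shorter closed subwalk; this is the notion of quasi-cycle
for walks of a relation. -/
def IsMinimalClosed (p : List D) : Prop :=
  IsClosed R p ∧ ∀ q, q <:+: p ++ p → q.length < p.length → ¬ IsClosed R q

/-- The analogue of `p ⟹ q` through a nod-path: a nonempty walk leads from `p` to `q` without
going around `p` first. -/
def Links (p q : List D) : Prop := ∃ o, o ≠ [] ∧ ¬ p <+: o ∧ (p ++ o ++ q).IsChain R

/-- No minimal closed walk is linked to itself. -/
def NoSelfLink : Prop := ∀ p, IsMinimalClosed R p → ¬ Links R p p

/-- The strict preorder of reachability: `y` can be reached from `x`, but not conversely. -/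
def Below (x y : D) : Prop := ReflTransGen R x y ∧ ¬ ReflTransGen R y x

/-- The analogue for walks of a chain of quasi-cycles. -/
def IsMinimalClosedChain (L : List (List D)) : Prop :=
  (∀ p ∈ L, IsMinimalClosed R p) ∧ L.Pairwise (fun p q => ¬ p.IsRotated q) ∧
    L.IsChain (fun p q => (p ++ q).IsChain R ∨ Links R p q)

variable {R}

theorem isChain_append_append {p q r : List D} (hpq : (p ++ q).IsChain R)
    (hqr : (q ++ r).IsChain R) (hq : q ≠ []) : (p ++ (q ++ r)).IsChain R :=
  List.append_assoc p q r ▸ hpq.append_overlap hqr hq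

theorem isChain_flatten {L : List (List D)} (hL : ∀ p ∈ L, p ≠ [] ∧ p.IsChain R)
    (h : L.IsChain fun p q => (p ++ q).IsChain R) : L.flatten.IsChain R := by
  refine (List.isChain_flatten fun hnil => (hL _ hnil).1 rfl).2 ⟨fun p hp => (hL p hp).2, ?_⟩
  exact h.imp fun p q hpq => (List.isChain_append.1 hpq).2.2

theorem transGen_of_isChain_append {p q : List D} (h : (p ++ q).IsChain R) {x y : D} (hx : x ∈ p)
    (hy : y ∈ q) : TransGen R x y :=
  (List.pairwise_append.1
    (List.isChain_iff_pairwise.1 (h.imp fun _ _ => TransGen.single))).2.2 x hx y hy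

theorem exists_isChain_append {p q : List D} (hp : p.IsChain R) (hq : q.IsChain R)
    (h : ∀ x ∈ p.getLast?, ∀ y ∈ q.head?, TransGen R x y) : ∃ o, (p ++ o ++ q).IsChain R := by
  rcases List.eq_nil_or_concat' p with rfl | ⟨p, x, rfl⟩
  · exact ⟨[], hq⟩
  rcases q with _ | ⟨y, q⟩
  · exact ⟨[], by simpa using hp⟩
  obtain ⟨z, hxz, hzy⟩ := TransGen.head'_iff.1 (h x (by simp) y (by simp))
  obtain ⟨l, hl, hlast⟩ := List.exists_isChain_cons_of_relationReflTransGen hzy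
  refine ⟨(z :: l).dropLast, ?_⟩
  have hxy : ([x] ++ (z :: l).dropLast ++ [y]).IsChain R := by
    rw [← hlast, List.append_assoc, List.dropLast_append_getLast]
    exact hl.cons_cons hxz
  have hpy : (p ++ [x] ++ ((z :: l).dropLast ++ [y])).IsChain R :=
    hp.append_overlap (by simpa using hxy) (by simp)
  rw [← List.append_assoc] at hpy
  simpa using hpy.append_overlap (l₃ := q) hq (by simp)

theorem IsClosed.isChain {p : List D} (hp : IsClosed R p) : p.IsChain R := hp.2.left_of_append

theorem IsClosed.transGen {p : List D} (hp : IsClosed R p) {x y : D} (hx : x ∈ p) (hy : y ∈ p) :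
    TransGen R x y :=
  transGen_of_isChain_append hp.2 hx hy

theorem IsClosed.exists_isChain_append {p q : List D} (hp : IsClosed R p) (hq : IsClosed R q)
    {x y : D} (hx : x ∈ p) (hy : y ∈ q) (hxy : ReflTransGen R x y) :
    ∃ o, (p ++ o ++ q).IsChain R := by
  refine RelWalk.exists_isChain_append hp.isChain hq.isChain fun a ha b hb => ?_
  exact ((hp.transGen (List.mem_of_getLast? ha) hx).trans_left hxy).trans
    (hq.transGen hy (List.mem_of_mem_head? hb))

theorem IsClosed.isChain_flatten_replicate {p : List D} (hp : IsClosed R p) (a : ℕ) :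
    (List.replicate a p).flatten.IsChain R :=
  isChain_flatten (fun _ hq => List.eq_of_mem_replicate hq ▸ ⟨hp.1, hp.isChain⟩)
    (List.isChain_replicate_of_rel a hp.2)

theorem exists_isClosed_cons {x : D} (hx : TransGen R x x) : ∃ l, IsClosed R (x :: l) := by
  obtain ⟨l, hl⟩ := exists_isChain_append (p := [x]) (q := [x]) (List.isChain_singleton x)
    (List.isChain_singleton x) (by simpa using hx)
  refine ⟨l, by simp, ?_⟩
  simpa using hl.append_overlap (l₃ := l) hl.left_of_append (by simp)

theorem exists_isMinimalClosed {x : D} (hx : TransGen R x x) :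
    ∃ p, IsMinimalClosed R p ∧ ∀ z ∈ p, ReflTransGen R x z ∧ ReflTransGen R z x := by
  obtain ⟨l, hl⟩ := exists_isClosed_cons hx
  obtain ⟨p, ⟨hp, hpx⟩, hmin⟩ := exists_minimalFor_of_wellFoundedLT
    (fun p => IsClosed R p ∧ ∀ z ∈ p, ReflTransGen R x z ∧ ReflTransGen R z x) List.length
    ⟨x :: l, hl, fun z hz => ⟨(hl.transGen (by simp) hz).to_reflTransGen,
      (hl.transGen hz (by simp)).to_reflTransGen⟩⟩
  refine ⟨p, ⟨hp, fun q hq hlt hclosed => hlt.not_ge (hmin ⟨hclosed, fun z hz => hpx z ?_⟩ hlt.le)⟩,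
    hpx⟩
  simpa using hq.subset hz

/-! ### Walks without self-links -/

theorem NoSelfLink.exists_eq_flatten_replicate (hR : NoSelfLink R) {p : List D}
    (hp : IsMinimalClosed R p) {o : List D} (ho : (p ++ o ++ p).IsChain R) :
    ∃ a, o = (List.replicate a p).flatten := by
  induction hn : o.length using Nat.strong_induction_on generalizing o with
  | _ n ih =>
    rcases eq_or_ne o [] with rfl | hne
    · exact ⟨0, rfl⟩
    obtain ⟨t, rfl⟩ : p <+: o := by
      by_contra hpo
      exact hR p hp ⟨o, hne, hpo, ho⟩
    have hlen := List.length_pos_iff.2 hp.1.1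
    obtain ⟨a, rfl⟩ := ih t.length (by rw [← hn, List.length_append]; omega)
      (ho.suffix ⟨p, by simp⟩) rfl
    exact ⟨a + 1, rfl⟩

theorem NoSelfLink.exists_prefix_flatten_replicate (hR : NoSelfLink R) {p l : List D}
    (hp : IsMinimalClosed R p) (hl : (p ++ l).IsChain R)
    (hback : ∀ z ∈ l, ∃ y ∈ p, ReflTransGen R z y) :
    ∃ a, l <+: (List.replicate a p).flatten := by
  obtain ⟨o, ho⟩ := exists_isChain_append hl hp.1.isChain fun x hx y hy => by
    have hyp := List.mem_of_mem_head? hy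
    rcases List.mem_append.1 (List.mem_of_getLast? hx) with hxp | hxl
    · exact hp.1.transGen hxp hyp
    · obtain ⟨z, hz, hxz⟩ := hback x hxl
      exact (hp.1.transGen hz hyp).trans_right hxz
  obtain ⟨a, ha⟩ := hR.exists_eq_flatten_replicate hp (o := l ++ o) (by simpa using ho)
  exact ⟨a, ha ▸ List.prefix_append l o⟩

theorem NoSelfLink.prefix_or_prefix (hR : NoSelfLink R) {p l m : List D}
    (hp : IsMinimalClosed R p) (hl : (p ++ l).IsChain R) (hm : (p ++ m).IsChain R)
    (hlp : ∀ z ∈ l, ∃ y ∈ p, ReflTransGen R z y) (hmp : ∀ z ∈ m, ∃ y ∈ p, ReflTransGen R z y) :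
    l <+: m ∨ m <+: l := by
  obtain ⟨a, ha⟩ := hR.exists_prefix_flatten_replicate hp hl hlp
  obtain ⟨b, hb⟩ := hR.exists_prefix_flatten_replicate hp hm hmp
  have hmono : ∀ {i j : ℕ}, i ≤ j →
      (List.replicate i p).flatten <+: (List.replicate j p).flatten := by
    intro i j hij
    obtain ⟨k, rfl⟩ := Nat.exists_eq_add_of_le hij
    rw [List.replicate_add, List.flatten_append]
    exact List.prefix_append _ _
  exact List.prefix_or_prefix_of_prefix (ha.trans (hmono (le_max_left a b)))
    (hb.trans (hmono (le_max_right a b)))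

theorem NoSelfLink.unique_successor (hR : NoSelfLink R) {x y z : D} (hy : R x y) (hz : R x z)
    (hyx : ReflTransGen R y x) (hzx : ReflTransGen R z x) : y = z := by
  obtain ⟨p, hp, hpx⟩ := exists_isMinimalClosed (TransGen.head' hy hyx)
  obtain ⟨h, hh⟩ := List.exists_mem_of_ne_nil p hp.1.1
  obtain ⟨s, hs⟩ := exists_isChain_append hp.1.isChain (List.isChain_singleton x) <| by
    intro a ha b hb
    obtain rfl : x = b := by simpa using hb
    have haa := hp.1.transGen (List.mem_of_getLast? ha) (List.mem_of_getLast? ha)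
    exact haa.trans_left (hpx a (List.mem_of_getLast? ha)).2
  have hchain : ∀ {w}, R x w → (p ++ (s ++ [x, w])).IsChain R := fun {w} hw => by
    simpa using hs.append_overlap (l₃ := [w]) (List.isChain_pair.2 hw) (by simp)
  have hback : ∀ {w}, R x w → ReflTransGen R w x →
      ∀ v ∈ s ++ [x, w], ∃ y ∈ p, ReflTransGen R v y := by
    intro w hw hwx v hv
    refine ⟨h, hh, ReflTransGen.trans ?_ (hpx h hh).1⟩
    rcases List.mem_append.1 hv with hvs | hvw
    · exact (transGen_of_isChain_append hs (List.mem_append_right p hvs)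
        (List.mem_singleton_self x)).to_reflTransGen
    · rcases List.mem_pair.1 hvw with rfl | rfl
      exacts [.refl, hwx]
  rcases hR.prefix_or_prefix hp (hchain hy) (hchain hz) (hback hy hyx) (hback hz hzx) with hyz | hzy
  · simpa [List.prefix_append_right_inj] using hyz
  · simpa [List.prefix_append_right_inj, eq_comm] using hzy

theorem IsClosed.rotate {u v : List D} (h : IsClosed R (u ++ v)) : IsClosed R (v ++ u) := by
  refine ⟨fun hnil => h.1 ?_, ?_⟩
  · rw [List.append_eq_nil_iff] at hnil ⊢
    exact hnil.symm
  · exact (isChain_append_append h.2 h.2 h.1).infix ⟨u, v, by simp⟩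

theorem NoSelfLink.mem_of_reach (hR : NoSelfLink R) {p q : List D} (hp : IsMinimalClosed R p)
    (hq : IsClosed R q) {x y : D} (hx : x ∈ p) (hy : y ∈ q) (hxy : ReflTransGen R x y)
    (hyx : ReflTransGen R y x) {z : D} (hz : z ∈ q) : z ∈ p := by
  obtain ⟨s, hs⟩ := hp.1.exists_isChain_append hq hx hy hxy
  obtain ⟨t, ht⟩ := hq.exists_isChain_append hp.1 hy hx hyx
  rw [List.append_assoc] at ht
  obtain ⟨a, ha⟩ := hR.exists_eq_flatten_replicate hp (o := s ++ q ++ t)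
    (by simpa using hs.append_overlap ht hq.1)
  have hmem : z ∈ (List.replicate a p).flatten := by simp [← ha, hz]
  obtain ⟨l, hl, hzl⟩ := List.mem_flatten.1 hmem
  rwa [List.eq_of_mem_replicate hl] at hzl

theorem NoSelfLink.isRotated (hR : NoSelfLink R) {p q : List D} (hp : IsMinimalClosed R p)
    (hq : IsMinimalClosed R q) {x y : D} (hx : x ∈ p) (hy : y ∈ q) (hxy : ReflTransGen R x y)
    (hyx : ReflTransGen R y x) : p.IsRotated q := by
  obtain ⟨c, q, rfl⟩ := List.exists_cons_of_ne_nil hq.1.1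
  have hmem : ∀ z ∈ c :: q, z ∈ p := fun z hz => hR.mem_of_reach hp hq.1 hx hy hxy hyx hz
  obtain ⟨u, v, rfl⟩ := List.append_of_mem (hmem c (by simp))
  have hclosed : IsClosed R (c :: v ++ u) := hp.1.rotate
  have hrot : (u ++ c :: v).IsRotated (c :: v ++ u) := List.isRotated_append
  have hlen : (u ++ c :: v).length = (c :: v ++ u).length := hrot.perm.length_eq
  suffices heq : c :: v ++ u = c :: q from heq ▸ hrot
  have hpv : ((u ++ c :: v) ++ (u ++ (c :: v ++ u))).IsChain R := by
    simpa using isChain_append_append hp.1.2 (hp.1.2.prefix ⟨c :: v, by simp⟩) hp.1.1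
  have hpq : ((u ++ c :: v) ++ (u ++ (c :: q))).IsChain R := by
    have hpc : ((u ++ c :: v ++ u) ++ [c]).IsChain R := hp.1.2.prefix ⟨v, by simp⟩
    simpa using hpc.append_overlap (l₃ := q) hq.1.isChain (by simp)
  rcases hR.prefix_or_prefix hp hpv hpq
      (fun z hz => ⟨z, by simp only [List.mem_append] at hz ⊢; tauto, .refl⟩)
      (fun z hz => ⟨z, (List.mem_append.1 hz).elim (List.mem_append_left _) (hmem z), .refl⟩)
    with hpre | hpre <;> rw [List.prefix_append_right_inj] at hpre
  · refine hpre.eq_of_length_le (not_lt.1 fun hlt => hq.2 _ ?_ hlt hclosed)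
    exact hpre.isInfix.trans (List.prefix_append _ _).isInfix
  · refine (hpre.eq_of_length_le (not_lt.1 fun hlt => hp.2 _ ?_ (hlen ▸ hlt) hq.1)).symm
    exact hpre.isInfix.trans ⟨u, c :: v, by simp⟩

/-! ### Chains of closed walks and chains of recurrent vertices -/

instance : IsStrictOrder D (Below R) where
  irrefl _ h := h.2 .refl
  trans _ _ _ h₁ h₂ := ⟨h₁.1.trans h₂.1, fun h => h₂.2 (h.trans h₁.1)⟩

theorem NoSelfLink.exists_below_chain (hR : NoSelfLink R) {L : List (List D)}
    (hL : IsMinimalClosedChain R L) :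
    ∃ L' : List D, (∀ x ∈ L', TransGen R x x) ∧ L'.IsChain (Below R) ∧ L'.length = L.length := by
  have hex : ∀ p ∈ L, ∃ x, x ∈ p := fun p hp => List.exists_mem_of_ne_nil p (hL.1 p hp).1.1
  rcases isEmpty_or_nonempty D with hD | hD
  · obtain rfl : L = [] := List.eq_nil_iff_forall_not_mem.2 fun p hp => hD.elim (hex p hp).choose
    exact ⟨[], by simp⟩
  choose! f hf using hex
  refine ⟨L.map f, ?_, ?_, List.length_map f⟩
  · simp only [List.forall_mem_map]
    exact fun p hp => (hL.1 p hp).1.transGen (hf p hp) (hf p hp)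
  · rw [List.isChain_map, List.isChain_iff_getElem]
    intro i hi
    have hp := List.getElem_mem (Nat.lt_of_succ_lt hi)
    have hq := List.getElem_mem hi
    have hreach : ReflTransGen R (f L[i]) (f L[i + 1]) := by
      rcases List.isChain_iff_getElem.1 hL.2.2 i hi with h | ⟨o, -, -, h⟩
      · exact (transGen_of_isChain_append h (hf _ hp) (hf _ hq)).to_reflTransGen
      · exact (transGen_of_isChain_append h (List.mem_append_left _ (hf _ hp))
          (hf _ hq)).to_reflTransGen
    exact ⟨hreach, fun hback => List.isChain_iff_getElem.1 hL.2.1.isChain i hi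
      (hR.isRotated (hL.1 _ hp) (hL.1 _ hq) (hf _ hp) (hf _ hq) hreach hback)⟩

theorem IsClosed.isChain_append_or_links {p q : List D} (hp : IsClosed R p) (hq : IsClosed R q)
    {x y : D} (hx : x ∈ p) (hy : y ∈ q) (hxy : ReflTransGen R x y) :
    (p ++ q).IsChain R ∨ Links R p q := by
  obtain ⟨o, ho, hmin⟩ := exists_minimalFor_of_wellFoundedLT
    (fun o => (p ++ o ++ q).IsChain R) List.length (hp.exists_isChain_append hq hx hy hxy)
  rcases eq_or_ne o [] with rfl | hne
  · exact .inl (by simpa using ho)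
  refine .inr ⟨o, hne, ?_, ho⟩
  rintro ⟨t, rfl⟩
  have hlen := hmin (j := t) (ho.suffix ⟨p, by simp⟩) (by simp)
  rw [List.length_append] at hlen
  have := List.length_pos_iff.2 hp.1
  omega

theorem exists_isMinimalClosedChain {L : List D} (hL : ∀ x ∈ L, TransGen R x x)
    (hchain : L.IsChain (Below R)) :
    ∃ L', IsMinimalClosedChain R L' ∧ L'.length = L.length := by
  choose! f hf hfx using fun x (hx : x ∈ L) => exists_isMinimalClosed (hL x hx)
  choose! g hg using fun x (hx : x ∈ L) => List.exists_mem_of_ne_nil (f x) (hf x hx).1.1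
  refine ⟨L.map f, ⟨?_, ?_, ?_⟩, List.length_map f⟩
  · simpa only [List.forall_mem_map] using hf
  · rw [List.pairwise_map]
    refine (List.isChain_iff_pairwise.1 hchain).imp_of_mem fun {x y} hx hy hxy hrot => hxy.2 ?_
    exact (hfx y hy _ (hrot.mem_iff.1 (hg x hx))).1.trans (hfx x hx _ (hg x hx)).2
  · rw [List.isChain_map, List.isChain_iff_getElem]
    intro i hi
    have hx := List.getElem_mem (Nat.lt_of_succ_lt hi)
    have hy := List.getElem_mem hi
    exact (hf _ hx).1.isChain_append_or_links (hf _ hy).1 (hg _ hx) (hg _ hy)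
      ((hfx _ hx _ (hg _ hx)).2.trans ((List.isChain_iff_getElem.1 hchain i hi).1.trans
        (hfx _ hy _ (hg _ hy)).1))

theorem NoSelfLink.exists_isGreatest_length [Finite D] (hR : NoSelfLink R) :
    ∃ d, IsGreatest {k | ∃ L, IsMinimalClosedChain R L ∧ L.length = k} d := by
  have := Fintype.ofFinite D
  have hbdd : BddAbove {k | ∃ L, IsMinimalClosedChain R L ∧ L.length = k} := by
    refine ⟨Fintype.card D, ?_⟩
    rintro _ ⟨L, hL, rfl⟩
    obtain ⟨L', -, hchain, hlen⟩ := hR.exists_below_chain hL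
    exact hlen ▸ (List.isChain_iff_pairwise.1 hchain).nodup.length_le_card
  exact ⟨_, Nat.sSup_mem ⟨0, [], by simp [IsMinimalClosedChain], rfl⟩ hbdd,
    fun k hk => le_csSup hbdd hk⟩

/-! ### Counting walks -/

variable (R) in
/-- The walks with at most `n` vertices, including the empty one. -/
def walks (n : ℕ) : Set (List D) := {l | l.IsChain R ∧ l.length ≤ n}

theorem finite_walks [Finite D] (n : ℕ) : (walks R n).Finite :=
  (List.finite_length_le D n).subset fun _ hl => hl.2

theorem walks_mono : Monotone (walks R) := fun _ _ h _ hl => ⟨hl.1, hl.2.trans h⟩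

theorem injective_flatten_map {α : Type*} {f : α → List D} (hf : Function.Injective f) {m : ℕ}
    (hm : 0 < m) (hlen : ∀ a, (f a).length = m) :
    Function.Injective fun l : List α => (l.map f).flatten := by
  have hne : ∀ a l, f a ++ l ≠ [] := fun a l hnil => by
    rw [List.append_eq_nil_iff] at hnil
    exact hm.ne' (hlen a ▸ List.length_eq_zero_iff.2 hnil.1)
  intro l l' h
  induction l generalizing l' with
  | nil => cases l' with
    | nil => rfl
    | cons b l' => exact absurd h.symm (hne b _)
  | cons a l ih => cases l' with
    | nil => exact absurd h (hne a _)
    | cons b l' =>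
      obtain ⟨hab, hll⟩ := List.append_inj h ((hlen a).trans (hlen b).symm)
      rw [hf hab, ih hll]

theorem card_pow_le_ncard_walks [Finite D] {α : Type*} [Fintype α] {f : α → List D}
    (hf : Function.Injective f) {m : ℕ} (hm : 0 < m) (hlen : ∀ a, (f a).length = m)
    (hfree : ∀ a b, (f a ++ f b).IsChain R) (n : ℕ) :
    Fintype.card α ^ n ≤ (walks R (m * n)).ncard := by
  have hwalk : ∀ l : List.Vector α n, (l.toList.map f).flatten ∈ walks R (m * n) := by
    refine fun l => ⟨isChain_flatten ?_ ?_, ?_⟩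
    · simp only [List.forall_mem_map]
      exact fun a _ => ⟨List.ne_nil_of_length_pos (hlen a ▸ hm), (hfree a a).left_of_append⟩
    · rw [List.isChain_map]
      exact (List.pairwise_of_forall hfree).isChain
    · simp [List.length_flatten, Function.comp_def, hlen, mul_comm]
  rw [← card_vector, ← Nat.card_eq_fintype_card, ← Nat.card_coe_set_eq]
  have := (finite_walks (R := R) (m * n)).to_subtype
  exact Nat.card_le_card_of_injective (fun l => ⟨_, hwalk l⟩) fun l l' h =>
    Subtype.ext (injective_flatten_map hf hm hlen (Subtype.ext_iff.1 h))

theorem IsMinimalClosed.append_ne_append_of_links {p o : List D} (hp : IsMinimalClosed R p)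
    (ho : o ≠ []) (hpo : ¬ p <+: o) (hop : (o ++ p).IsChain R) : p ++ o ≠ o ++ p := by
  intro heq
  rcases List.prefix_or_prefix_of_prefix (List.prefix_append p o)
    (heq ▸ List.prefix_append o p) with hpre | ⟨t, rfl⟩
  · exact hpo hpre
  · have ht : t ≠ [] := by
      rintro rfl
      exact hpo (by simp)
    refine hp.2 o ⟨[], t ++ (o ++ t), by simp⟩ ?_ ⟨ho, hop.prefix ⟨t, by simp⟩⟩
    rw [List.length_append]
    exact Nat.lt_add_of_pos_right (List.length_pos_iff.2 ht)

theorem IsMinimalClosed.exists_two_pow_le_ncard_walks [Finite D] {p : List D}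
    (hp : IsMinimalClosed R p) (h : Links R p p) :
    ∃ m, 1 ≤ m ∧ ∀ n, 2 ^ n ≤ (walks R (m * n)).ncard := by
  obtain ⟨o, ho, hpo, hpop⟩ := h
  have hp_o : (p ++ o).IsChain R := hpop.left_of_append
  have ho_p : (o ++ p).IsChain R := (List.append_assoc p o p ▸ hpop).right_of_append
  let F : Bool → List (List D) := fun b => bif b then [p, p, o] else [p, o, p]
  have hne := hp.append_ne_append_of_links ho hpo ho_p
  have hinj : Function.Injective fun b => (F b).flatten := by
    rw [Bool.injective_iff]
    simpa [F] using hne.symm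
  have hpos : 0 < p.length + p.length + o.length := by
    have := List.length_pos_iff.2 ho
    omega
  refine ⟨_, hpos, fun n => card_pow_le_ncard_walks hinj hpos ?_ (fun a b => ?_) n⟩
  · simp [F, add_comm, add_assoc]
  · rw [← List.flatten_append]
    refine isChain_flatten ?_ ?_ <;> rcases a with _ | _ <;> rcases b with _ | _ <;>
      simp [F, hp.1.1, hp.1.2, ho, hp_o, ho_p, hp.1.isChain, ho_p.left_of_append]

variable (R) in
/-- The walks with first vertex `x` and at most `n` vertices. -/
def walksFrom (x : D) (n : ℕ) : Set (List D) := {l | l ∈ walks R n ∧ x ∈ l.head?}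

theorem finite_walksFrom [Finite D] (x : D) (n : ℕ) : (walksFrom R x n).Finite :=
  (finite_walks n).subset fun _ hl => hl.1

theorem IsClosed.isChain_flatten_replicate_append {p q : List D} (hp : IsClosed R p)
    (hq : (p ++ q).IsChain R) (a : ℕ) : ((List.replicate (a + 1) p).flatten ++ q).IsChain R := by
  have hpow := hp.isChain_flatten_replicate (a + 1)
  rw [List.replicate_succ', List.flatten_concat] at hpow ⊢
  exact hpow.append_overlap hq hp.1

theorem IsClosed.mul_ncard_le_ncard_walksFrom [Finite D] [DecidableEq D] {c : D} {w : List D}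
    (hw : IsClosed R (c :: w)) {T : Set (List D)} {k n : ℕ}
    (hT : ∀ t ∈ T, (c :: w ++ t).IsChain R ∧ t.length ≤ n) (hcount : ∀ t ∈ T, t.count c = k)
    (m : ℕ) : m * T.ncard ≤ (walksFrom R c ((c :: w).length * m + n)).ncard := by
  have hmem : ∀ x : Fin m × T, (List.replicate (x.1 + 1) (c :: w)).flatten ++ x.2.1 ∈
      walksFrom R c ((c :: w).length * m + n) := by
    rintro ⟨a, t, ht⟩
    refine ⟨⟨hw.isChain_flatten_replicate_append (hT t ht).1 a, ?_⟩,
      by simp [List.replicate_succ]⟩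
    have hlen : (c :: w).length * (a + 1) ≤ (c :: w).length * m := Nat.mul_le_mul_left _ a.2
    rw [List.length_append, List.length_flatten, List.map_replicate, List.sum_replicate,
      smul_eq_mul, mul_comm]
    exact Nat.add_le_add hlen (hT t ht).2
  have := (finite_walksFrom (R := R) c ((c :: w).length * m + n)).to_subtype
  rw [← Nat.card_coe_set_eq T, ← Nat.card_coe_set_eq, ← Nat.card_fin m, ← Nat.card_prod,
    Nat.card_fin]
  refine Nat.card_le_card_of_injective (fun x => ⟨_, hmem x⟩) ?_
  rintro ⟨a, s, hs⟩ ⟨b, t, ht⟩ hab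
  have heq := Subtype.ext_iff.1 hab
  have hcounts := congrArg (List.count c) heq
  simp only [List.count_append, hcount s hs, hcount t ht, List.count_flatten, List.map_replicate,
    List.sum_replicate, smul_eq_mul, add_left_inj] at hcounts
  have hpos : 0 < (c :: w).count c := List.count_pos_iff.2 (by simp)
  obtain rfl : a = b := Fin.ext (Nat.succ_injective (Nat.eq_of_mul_eq_mul_right hpos hcounts))
  simpa using heq

theorem Below.exists_mul_ncard_le_ncard_walksFrom [Finite D] {c c' : D} (h : Below R c c')
    (hc : TransGen R c c) (hc' : TransGen R c' c') :
    ∃ a b, ∀ m n, m * (walksFrom R c' n).ncard ≤ (walksFrom R c (a * m + (b + n))).ncard := by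
  classical
  obtain ⟨w, hw⟩ := exists_isClosed_cons hc
  obtain ⟨w', hw'⟩ := exists_isClosed_cons hc'
  obtain ⟨u, hu⟩ := hw.exists_isChain_append hw' List.mem_cons_self List.mem_cons_self h.1
  have hT : ∀ n, ∀ t ∈ (u ++ ·) '' walksFrom R c' n,
      ((c :: w ++ t).IsChain R ∧ t.length ≤ u.length + n) ∧ t.count c = u.count c := by
    rintro n _ ⟨t, ⟨⟨ht, hlen⟩, hhead⟩, rfl⟩
    obtain ⟨t, rfl⟩ := List.head?_eq_some_iff.1 hhead
    have huc : (c :: w ++ u ++ [c']).IsChain R := hu.prefix ⟨w', by simp⟩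
    have huct : (c :: w ++ u ++ [c'] ++ t).IsChain R := huc.append_overlap ht (by simp)
    refine ⟨⟨by simpa using huct, by simpa using hlen⟩, ?_⟩
    rw [List.count_append, Nat.add_eq_left, List.count_eq_zero]
    rintro (_ | ⟨_, hct⟩)
    · exact h.2 .refl
    · exact h.2 (transGen_of_isChain_append (p := [c']) ht (by simp) hct).to_reflTransGen
  refine ⟨(c :: w).length, u.length, fun m n => ?_⟩
  rw [← Set.ncard_image_of_injective _ (List.append_right_injective u)]
  exact hw.mul_ncard_le_ncard_walksFrom (fun t ht => (hT n t ht).1) (fun t ht => (hT n t ht).2) m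

theorem exists_pow_le_ncard_walksFrom [Finite D] {c : D} {L : List D}
    (hL : ∀ x ∈ c :: L, TransGen R x x) (hchain : (c :: L).IsChain (Below R)) :
    ∃ A, 1 ≤ A ∧ ∀ m, 1 ≤ m → m ^ (L.length + 1) ≤ (walksFrom R c (A * m)).ncard := by
  classical
  induction L generalizing c with
  | nil =>
    obtain ⟨w, hw⟩ := exists_isClosed_cons (hL c (by simp))
    refine ⟨(c :: w).length, by simp, fun m _ => ?_⟩
    simpa using hw.mul_ncard_le_ncard_walksFrom (T := {[]}) (k := 0) (n := 0)
      (by simpa using hw.isChain) (by simp) m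
  | cons c' L ih =>
    rw [List.isChain_cons_cons] at hchain
    obtain ⟨A, hA1, hA⟩ := ih (fun x hx => hL x (List.mem_cons_of_mem _ hx)) hchain.2
    obtain ⟨a, b, hab⟩ :=
      hchain.1.exists_mul_ncard_le_ncard_walksFrom (hL c (by simp)) (hL c' (by simp))
    refine ⟨a + b + A, by omega, fun m hm => ?_⟩
    calc m ^ ((c' :: L).length + 1) = m * m ^ (L.length + 1) := pow_succ' _ _
      _ ≤ m * (walksFrom R c' (A * m)).ncard := Nat.mul_le_mul_left _ (hA m hm)
      _ ≤ (walksFrom R c (a * m + (b + A * m))).ncard := hab m _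
      _ ≤ (walksFrom R c ((a + b + A) * m)).ncard := by
        refine Set.ncard_le_ncard (fun l hl => ⟨walks_mono ?_ hl.1, hl.2⟩) (finite_walksFrom _ _)
        have : b ≤ b * m := Nat.le_mul_of_pos_right _ hm
        simp only [add_mul]
        omega

theorem NoSelfLink.exists_pow_le_ncard_walks [Finite D] (hR : NoSelfLink R) {L : List (List D)}
    (hL : IsMinimalClosedChain R L) :
    ∃ A, 1 ≤ A ∧ ∀ m, 1 ≤ m → m ^ L.length ≤ (walks R (A * m)).ncard := by
  obtain ⟨L', hrec, hchain, hlen⟩ := hR.exists_below_chain hL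
  rw [← hlen]
  cases L' with
  | nil =>
    refine ⟨1, le_rfl, fun m _ => ?_⟩
    exact (Set.ncard_pos (finite_walks _)).2 ⟨[], .nil, Nat.zero_le _⟩
  | cons c L' =>
    obtain ⟨A, hA1, hA⟩ := exists_pow_le_ncard_walksFrom hrec hchain
    exact ⟨A, hA1, fun m hm => (hA m hm).trans
      (Set.ncard_le_ncard (fun _ hl => hl.1) (finite_walks _))⟩

theorem exists_sum_le_mul_pow {ι : Type*} {s : Finset ι} {f : ι → ℕ → ℕ} {d : ℕ}
    (h : ∀ i ∈ s, ∃ C, ∀ n, f i n ≤ C * n ^ d) : ∃ C, ∀ n, ∑ i ∈ s, f i n ≤ C * n ^ d := by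
  choose! C hC using h
  exact ⟨∑ i ∈ s, C i, fun n => Finset.sum_mul s C (n ^ d) ▸
    Finset.sum_le_sum fun i hi => hC i hi n⟩

theorem ncard_walksFrom_zero (x : D) : (walksFrom R x 0).ncard = 0 := by
  suffices h : walksFrom R x 0 = ∅ by rw [h, Set.ncard_empty]
  rw [Set.eq_empty_iff_forall_notMem]
  rintro l ⟨⟨-, hlen⟩, hhead⟩
  simp [List.length_eq_zero_iff.1 (Nat.le_zero.1 hlen)] at hhead

open Classical in
theorem ncard_walksFrom_succ_le [Fintype D] (x : D) (n : ℕ) :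
    (walksFrom R x (n + 1)).ncard ≤ 1 + ∑ y with R x y, (walksFrom R y n).ncard := by
  have hsub : walksFrom R x (n + 1) ⊆
      {[x]} ∪ ⋃ y ∈ Finset.univ.filter (R x), List.cons x '' walksFrom R y n := by
    rintro l ⟨⟨hl, hlen⟩, hhead⟩
    obtain ⟨l, rfl⟩ := List.head?_eq_some_iff.1 hhead
    rcases l with _ | ⟨y, l⟩
    · exact .inl rfl
    · rw [List.isChain_cons_cons] at hl
      exact .inr (Set.mem_iUnion₂.2 ⟨y, by simpa using hl.1, _,
        ⟨⟨hl.2, Nat.le_of_succ_le_succ hlen⟩, rfl⟩, rfl⟩)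
  have hfin : (⋃ y ∈ Finset.univ.filter (R x), List.cons x '' walksFrom R y n).Finite :=
    Set.Finite.biUnion (Finset.finite_toSet _) fun y _ => (finite_walksFrom y n).image _
  calc (walksFrom R x (n + 1)).ncard
      ≤ _ := Set.ncard_le_ncard hsub ((Set.finite_singleton _).union hfin)
    _ ≤ _ := Set.ncard_union_le _ _
    _ ≤ 1 + ∑ y with R x y, (List.cons x '' walksFrom R y n).ncard := by
      rw [Set.ncard_singleton]
      exact Nat.add_le_add_left (Finset.set_ncard_biUnion_le _ _) 1
    _ ≤ _ := Nat.add_le_add_left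
      (Finset.sum_le_sum fun y _ => Set.ncard_image_le (finite_walksFrom y n)) 1

theorem exists_ncard_walksFrom_le_of_forall_rel [Finite D] {x : D} {d : ℕ}
    (h : ∀ y, R x y → ∃ C, ∀ n, (walksFrom R y n).ncard ≤ C * n ^ d) :
    ∃ C, ∀ n, (walksFrom R x n).ncard ≤ C * n ^ d := by
  classical
  have := Fintype.ofFinite D
  obtain ⟨C, hC⟩ := exists_sum_le_mul_pow (s := Finset.univ.filter (R x)) fun y hy =>
    h y (Finset.mem_filter.1 hy).2
  refine ⟨1 + C, fun n => ?_⟩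
  cases n with
  | zero => simp [ncard_walksFrom_zero]
  | succ n =>
    calc (walksFrom R x (n + 1)).ncard ≤ 1 + C * n ^ d :=
          (ncard_walksFrom_succ_le x n).trans (Nat.add_le_add_left (hC n) 1)
      _ ≤ 1 * (n + 1) ^ d + C * (n + 1) ^ d := by
        gcongr
        · exact Nat.le_mul_of_pos_right 1 (Nat.pow_pos n.succ_pos)
        · omega
      _ = (1 + C) * (n + 1) ^ d := (add_mul _ _ _).symm

open Classical in
theorem NoSelfLink.sum_ncard_walksFrom_le [Fintype D] (hR : NoSelfLink R) {x z : D}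
    {n b : ℕ} (hxz : ReflTransGen R x z)
    (hb : ∀ y, ReflTransGen R x y → ReflTransGen R y x → (walksFrom R y n).ncard ≤ b) :
    ∑ y with R z y, (walksFrom R y n).ncard ≤
      b + ∑ y with Below R x y, (walksFrom R y n).ncard := by
  rw [← Finset.sum_filter_add_sum_filter_not _ (fun y => ReflTransGen R y x)]
  refine Nat.add_le_add ?_ (Finset.sum_le_sum_of_subset fun y hy => ?_)
  · have hcard : ((Finset.univ.filter (R z)).filter fun y => ReflTransGen R y x).card ≤ 1 := by
      refine Finset.card_le_one.2 fun y hy y' hy' => ?_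
      simp only [Finset.mem_filter, Finset.mem_univ, true_and] at hy hy'
      exact hR.unique_successor hy.1 hy'.1 (hy.2.trans hxz) (hy'.2.trans hxz)
    refine (Finset.sum_le_card_nsmul _ _ b fun y hy => ?_).trans
      ((Nat.mul_le_mul_right b hcard).trans_eq (one_mul b))
    simp only [Finset.mem_filter, Finset.mem_univ, true_and] at hy
    exact hb y (hxz.tail hy.1) hy.2
  · simp only [Finset.mem_filter, Finset.mem_univ, true_and] at hy ⊢
    exact ⟨hxz.tail hy.1, hy.2⟩

theorem NoSelfLink.exists_ncard_walksFrom_le_of_forall_below [Finite D] (hR : NoSelfLink R)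
    {x : D} {d : ℕ} (h : ∀ y, Below R x y → ∃ C, ∀ n, (walksFrom R y n).ncard ≤ C * n ^ d) :
    ∃ C, ∀ n, (walksFrom R x n).ncard ≤ C * n ^ (d + 1) := by
  classical
  have := Fintype.ofFinite D
  obtain ⟨C, hC⟩ := exists_sum_le_mul_pow (s := Finset.univ.filter (Below R x)) fun y hy =>
    h y (Finset.mem_filter.1 hy).2
  refine ⟨1 + C, fun n => ?_⟩
  suffices hz : ∀ z, ReflTransGen R x z → ReflTransGen R z x →
      (walksFrom R z n).ncard ≤ (1 + C) * n ^ (d + 1) from hz x .refl .refl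
  induction n with
  | zero => simp [ncard_walksFrom_zero]
  | succ n ih =>
    intro z hxz _
    have hpow : n ^ d ≤ (n + 1) ^ d := Nat.pow_le_pow_left n.le_succ d
    have hone : 1 ≤ (n + 1) ^ d := Nat.one_le_pow _ _ n.succ_pos
    calc (walksFrom R z (n + 1)).ncard
        ≤ 1 + ((1 + C) * n ^ (d + 1) + C * n ^ d) :=
          (ncard_walksFrom_succ_le z n).trans (Nat.add_le_add_left
            ((hR.sum_ncard_walksFrom_le hxz ih).trans (Nat.add_le_add_left (hC n) _)) 1)
      _ = (1 + C) * n ^ d * n + 1 + C * n ^ d := by ring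
      _ ≤ (1 + C) * (n + 1) ^ d * n + (n + 1) ^ d + C * (n + 1) ^ d := by gcongr
      _ = (1 + C) * (n + 1) ^ (d + 1) := by ring

theorem NoSelfLink.exists_ncard_walksFrom_le [Finite D] (hR : NoSelfLink R) (x : D)
    {d : ℕ} (hd : ∀ L : List D, (∀ c ∈ L, TransGen R c c ∧ ReflTransGen R x c) →
      L.IsChain (Below R) → L.length ≤ d) :
    ∃ C, ∀ n, (walksFrom R x n).ncard ≤ C * n ^ d := by
  have hwf : WellFounded (Function.swap (Below R)) := Finite.wellFounded_of_trans_of_irrefl _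
  induction x using hwf.induction generalizing d with
  | _ x ih =>
  by_cases hx : TransGen R x x
  · obtain ⟨d, rfl⟩ := Nat.exists_eq_add_of_le' (hd [x] (by simp [hx, ReflTransGen.refl])
      (List.isChain_singleton x))
    refine hR.exists_ncard_walksFrom_le_of_forall_below fun y hxy => ih y hxy fun L hL hchain => ?_
    refine Nat.le_of_succ_le_succ (hd (x :: L) ?_ (hchain.cons fun z hz => ?_))
    · simp only [List.forall_mem_cons]
      exact ⟨⟨hx, .refl⟩, fun c hc => ⟨(hL c hc).1, hxy.1.trans (hL c hc).2⟩⟩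
    · have hyz := (hL z (List.mem_of_mem_head? hz)).2
      exact ⟨hxy.1.trans hyz, fun hzx => hxy.2 (hyz.trans hzx)⟩
  · refine exists_ncard_walksFrom_le_of_forall_rel fun y hxy =>
      ih y ⟨.single hxy, fun hyx => hx (.head' hxy hyx)⟩ fun L hL => hd L fun c hc => ?_
    exact ⟨(hL c hc).1, .head hxy (hL c hc).2⟩

theorem NoSelfLink.exists_ncard_walks_le [Finite D] (hR : NoSelfLink R) {d : ℕ}
    (hd : ∀ L, IsMinimalClosedChain R L → L.length ≤ d) :
    ∃ B, 1 ≤ B ∧ ∀ n, 1 ≤ n → (walks R n).ncard ≤ B * n ^ d := by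
  have := Fintype.ofFinite D
  obtain ⟨C, hC⟩ := exists_sum_le_mul_pow (s := Finset.univ) fun x _ =>
    hR.exists_ncard_walksFrom_le x fun L hL hchain => by
      obtain ⟨L', hL', hlen⟩ := exists_isMinimalClosedChain (fun c hc => (hL c hc).1) hchain
      exact hlen ▸ hd L' hL'
  refine ⟨1 + C, by omega, fun n hn => ?_⟩
  have hsub : walks R n ⊆ {[]} ∪ ⋃ x ∈ Finset.univ, walksFrom R x n := by
    intro l hl
    rcases l with _ | ⟨x, l⟩
    · exact .inl rfl
    · exact .inr (Set.mem_iUnion₂.2 ⟨x, Finset.mem_univ x, hl, rfl⟩)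
  have hfin : (⋃ x ∈ Finset.univ, walksFrom R x n).Finite :=
    Set.Finite.biUnion (Finset.finite_toSet _) fun x _ => finite_walksFrom x n
  calc (walks R n).ncard ≤ _ := Set.ncard_le_ncard hsub ((Set.finite_singleton _).union hfin)
    _ ≤ _ := Set.ncard_union_le _ _
    _ ≤ 1 + C * n ^ d := by
      rw [Set.ncard_singleton]
      exact Nat.add_le_add_left ((Finset.set_ncard_biUnion_le _ _).trans (hC n)) 1
    _ ≤ 1 * n ^ d + C * n ^ d := by
      gcongr
      exact Nat.le_mul_of_pos_right 1 (Nat.pow_pos hn)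
    _ = (1 + C) * n ^ d := (add_mul _ _ _).symm

end RelWalk

/-! ### Reduced words in matrix entries -/

/-- The index pattern of a family of matrices `X` with starred transposes `X*` for which `X X*` and
`X* X` are diagonal with idempotents `v : V` on the diagonal. The indices `I` are the rows and
columns of all the matrices, `vtx a` is the idempotent of the index `a`, `cross a` is the set of
columns of a row `a` and vice versa, and `Adj a b` says that the entry at `(a, b)` need not vanish.
The pair `(a, b)` stands for an entry of `X` if `a` is a row and for an entry of `X*` if `a` is a
column. The product of the entries at `(a, b)` and `(b, d)` is eliminated if `b = pivot a`. -/
structure MatrixPattern (V I : Type*) where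
  vtx : I → V
  cross : I → Finset I
  pivot : I → I
  Adj : I → I → Prop
  adj_symm : ∀ {a b}, Adj a b → Adj b a
  mem_cross_of_adj : ∀ {a b}, Adj a b → b ∈ cross a
  mem_cross_symm : ∀ {a b}, b ∈ cross a → a ∈ cross b
  cross_eq : ∀ {a b d}, b ∈ cross a → b ∈ cross d → cross a = cross d
  pivot_eq : ∀ {a b d}, b ∈ cross a → b ∈ cross d → pivot a = pivot d
  adj_pivot : ∀ a, Adj a (pivot a)

namespace MatrixPattern

variable {V I : Type*} (S : MatrixPattern V I)

/-- The composite of the two entries is to be rewritten by a relation. -/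
def Clash (x y : I × I) : Prop := x.2 = y.1 ∧ x.2 = S.pivot x.1

/-- The source of the path that consists of the entries `l` and ends at the vertex `v`. -/
def wordSrc : List (I × I) → V → V
  | [], v => v
  | x :: _, _ => S.vtx x.1

/-- The entries `l` form a path that ends at `v` and in which no two consecutive entries clash. -/
def Reduced : List (I × I) → V → Prop
  | [], _ => True
  | x :: l, v => S.Adj x.1 x.2 ∧ S.vtx x.2 = S.wordSrc l v ∧ (∀ y ∈ l.head?, ¬ S.Clash x y) ∧
      Reduced l v

/-- The vector space with basis the reduced words. -/
abbrev WordSpace (K : Type*) [Field K] : Type _ :=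
  {w : List (I × I) × V // S.Reduced w.1 w.2} →₀ K

variable {S}

theorem Clash.adj {x y : I × I} (h : S.Clash x y) : S.Adj x.1 x.2 := h.2 ▸ S.adj_pivot x.1

theorem Clash.congr_left {a b d : I} {y : I × I} (h : S.Clash (a, b) y) (hd : b ∈ S.cross d) :
    S.Clash (d, b) y :=
  ⟨h.1, h.2.trans (S.pivot_eq (S.mem_cross_of_adj h.adj) hd)⟩

theorem not_clash_of_ne_pivot {a b : I} (h : b ≠ S.pivot a) (d : I) (l : List (I × I)) :
    ∀ y ∈ ((b, d) :: l).head?, ¬ S.Clash (a, b) y :=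
  fun _ _ hcl => h hcl.2

section Operators

variable (K : Type*) [Field K]

open Classical in
/-- The basis vector of a reduced word, and `0` for any other word. -/
noncomputable def wordVec (l : List (I × I)) (v : V) : S.WordSpace K :=
  if h : S.Reduced l v then Finsupp.single ⟨(l, v), h⟩ 1 else 0

open Classical in
/-- The product of an entry and a reduced word, rewritten as a combination of reduced words. -/
noncomputable def entryMul (x : I × I) : List (I × I) → V → S.WordSpace K
  | y :: l, v =>
    if S.Clash x y then
      (if x.1 = y.2 then wordVec K l v else 0) -
        ∑ b ∈ (S.cross x.1).erase x.2, wordVec K ((x.1, b) :: (b, y.2) :: l) v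
    else wordVec K (x :: y :: l) v
  | [], v => wordVec K [x] v

/-- Left multiplication by an entry. -/
noncomputable def entryOp (x : I × I) : Module.End K (S.WordSpace K) :=
  Finsupp.linearCombination K fun w => entryMul K x w.1.1 w.1.2

open Classical in
/-- Left multiplication by a vertex. -/
noncomputable def vertexOp (u : V) : Module.End K (S.WordSpace K) :=
  Finsupp.linearCombination K fun w =>
    if S.wordSrc w.1.1 w.1.2 = u then wordVec K w.1.1 w.1.2 else 0

variable {K}

theorem wordVec_of_reduced {l : List (I × I)} {v : V} (h : S.Reduced l v) :
    wordVec K l v = Finsupp.single ⟨(l, v), h⟩ 1 := dif_pos h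

theorem wordVec_of_not_reduced {l : List (I × I)} {v : V} (h : ¬ S.Reduced l v) :
    (wordVec K l v : S.WordSpace K) = 0 := dif_neg h

theorem wordVec_cons_of_not_reduced {x : I × I} {l : List (I × I)} {v : V}
    (h : ¬ S.Reduced l v) : (wordVec K (x :: l) v : S.WordSpace K) = 0 :=
  wordVec_of_not_reduced fun h' => h h'.2.2.2

theorem wordSpace_hom_ext {M : Type*} [AddCommGroup M] [Module K M] {f g : S.WordSpace K →ₗ[K] M}
    (h : ∀ l v, S.Reduced l v → f (wordVec K l v) = g (wordVec K l v)) : f = g := by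
  ext1 ⟨⟨l, v⟩, hlv⟩
  refine LinearMap.ext_ring ?_
  simpa [wordVec_of_reduced hlv] using h l v hlv

theorem entryOp_wordVec {l : List (I × I)} {v : V} (h : S.Reduced l v) (x : I × I) :
    entryOp K x (wordVec K l v : S.WordSpace K) = entryMul K x l v := by
  simp [entryOp, wordVec_of_reduced h]

theorem entryOp_wordVec_of_not_clash {x : I × I} {l : List (I × I)} {v : V}
    (h : ∀ y ∈ l.head?, ¬ S.Clash x y) :
    entryOp K x (wordVec K l v : S.WordSpace K) = wordVec K (x :: l) v := by
  by_cases hl : S.Reduced l v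
  · rw [entryOp_wordVec hl]
    cases l with
    | nil => rfl
    | cons y l => exact if_neg (h y rfl)
  · rw [wordVec_of_not_reduced hl, wordVec_cons_of_not_reduced hl, map_zero]

theorem entryOp_wordVec_of_clash [DecidableEq I] {a b d : I} {l : List (I × I)} {v : V}
    (h : S.Reduced ((b, d) :: l) v) (hb : b = S.pivot a) :
    entryOp K (a, b) (wordVec K ((b, d) :: l) v : S.WordSpace K) =
      (if a = d then wordVec K l v else 0) -
        ∑ b' ∈ (S.cross a).erase b, wordVec K ((a, b') :: (b', d) :: l) v := by
  rw [entryOp_wordVec h]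
  refine (if_pos ⟨rfl, hb⟩).trans ?_
  congr!

open Classical in
theorem vertexOp_wordVec (u : V) (l : List (I × I)) (v : V) :
    vertexOp K u (wordVec K l v : S.WordSpace K) =
      if S.wordSrc l v = u then wordVec K l v else 0 := by
  by_cases h : S.Reduced l v
  · simp [vertexOp, wordVec_of_reduced h]
  · simp [wordVec_of_not_reduced h]

theorem vertexOp_wordVec_of_eq {u : V} {l : List (I × I)} {v : V} (h : S.wordSrc l v = u) :
    vertexOp K u (wordVec K l v : S.WordSpace K) = wordVec K l v := by
  classical
  rw [vertexOp_wordVec, if_pos h]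

theorem entryOp_wordVec_of_ne {x : I × I} {l : List (I × I)} {v : V}
    (h : S.vtx x.2 ≠ S.wordSrc l v) : entryOp K x (wordVec K l v : S.WordSpace K) = 0 := by
  rw [entryOp_wordVec_of_not_clash,
    wordVec_of_not_reduced fun h' : S.Reduced (x :: l) v => h h'.2.1]
  intro y hy hcl
  obtain ⟨l, rfl⟩ := List.head?_eq_some_iff.1 hy
  exact h (congrArg S.vtx hcl.1)

end Operators

/-- Elements `p v` and `x a b` of a ring that multiply like vertices and matrix entries over the
pattern. -/
structure IsRealization {A : Type*} [NonUnitalRing A] (S : MatrixPattern V I) (p : V → A)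
    (x : I → I → A) : Prop where
  vertex_mul_self (u : V) : p u * p u = p u
  vertex_mul_of_ne {u v : V} (h : u ≠ v) : p u * p v = 0
  vertex_mul (a b : I) : p (S.vtx a) * x a b = x a b
  mul_vertex (a b : I) : x a b * p (S.vtx b) = x a b
  eq_zero {a b : I} (h : ¬ S.Adj a b) : x a b = 0
  sum_mul_self (a : I) : ∑ b ∈ S.cross a, x a b * x b a = p (S.vtx a)
  sum_mul_of_ne {a b d : I} (hba : b ∈ S.cross a) (hbd : b ∈ S.cross d) (h : a ≠ d) :
    ∑ b ∈ S.cross a, x a b * x b d = 0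

section Operators

variable {K : Type*} [Field K]

theorem vertexOp_mul_vertexOp_self (u : V) :
    (vertexOp K u * vertexOp K u : Module.End K (S.WordSpace K)) = vertexOp K u := by
  refine wordSpace_hom_ext fun l v _ => ?_
  rw [Module.End.mul_apply, vertexOp_wordVec]
  split_ifs with h
  · exact vertexOp_wordVec_of_eq h
  · exact map_zero _

theorem vertexOp_mul_vertexOp_of_ne {u w : V} (h : u ≠ w) :
    (vertexOp K u * vertexOp K w : Module.End K (S.WordSpace K)) = 0 := by
  refine wordSpace_hom_ext fun l v _ => ?_
  rw [Module.End.mul_apply, vertexOp_wordVec, LinearMap.zero_apply]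
  split_ifs with hw
  · rw [vertexOp_wordVec, if_neg fun hu => h (hu.symm.trans hw)]
  · exact map_zero _

theorem entryOp_mul_vertexOp (a b : I) :
    (entryOp K (a, b) * vertexOp K (S.vtx b) : Module.End K (S.WordSpace K)) =
      entryOp K (a, b) := by
  refine wordSpace_hom_ext fun l v _ => ?_
  rw [Module.End.mul_apply, vertexOp_wordVec]
  split_ifs with h
  · rfl
  · rw [map_zero, entryOp_wordVec_of_ne (Ne.symm h)]

theorem vertexOp_mul_entryOp (a b : I) :
    (vertexOp K (S.vtx a) * entryOp K (a, b) : Module.End K (S.WordSpace K)) =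
      entryOp K (a, b) := by
  classical
  refine wordSpace_hom_ext fun l v hlv => ?_
  rw [Module.End.mul_apply]
  by_cases hcl : ∀ y ∈ l.head?, ¬ S.Clash (a, b) y
  · rw [entryOp_wordVec_of_not_clash hcl]
    exact vertexOp_wordVec_of_eq rfl
  · push Not at hcl
    obtain ⟨⟨_, d⟩, hy, rfl, hb⟩ := hcl
    obtain ⟨l, rfl⟩ := List.head?_eq_some_iff.1 hy
    rw [entryOp_wordVec_of_clash hlv hb, map_sub, map_sum]
    congr 1
    · split_ifs with had
      · exact vertexOp_wordVec_of_eq (hlv.2.1.symm.trans (congrArg S.vtx had.symm))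
      · exact map_zero _
    · exact Finset.sum_congr rfl fun b' _ => vertexOp_wordVec_of_eq rfl

theorem entryOp_eq_zero {a b : I} (h : ¬ S.Adj a b) :
    (entryOp K (a, b) : Module.End K (S.WordSpace K)) = 0 := by
  refine wordSpace_hom_ext fun l v _ => ?_
  rw [entryOp_wordVec_of_not_clash fun y _ hcl => h hcl.adj,
    wordVec_of_not_reduced fun hl : S.Reduced ((a, b) :: l) v => h hl.1, LinearMap.zero_apply]

theorem sum_entryOp_entryOp_wordVec_of_not_clash [DecidableEq I] {a b d : I}
    (hba : b ∈ S.cross a) (hbd : b ∈ S.cross d) {l : List (I × I)} {v : V}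
    (hs : S.vtx d = S.wordSrc l v) (hcl : ∀ y ∈ l.head?, ¬ S.Clash (S.pivot d, d) y) :
    ∑ b ∈ S.cross a, entryOp K (a, b) (entryOp K (b, d) (wordVec K l v : S.WordSpace K)) =
      if a = d then wordVec K l v else 0 := by
  by_cases hl : S.Reduced l v
  swap
  · simp [wordVec_of_not_reduced hl]
  have hpivot : S.pivot a = S.pivot d := S.pivot_eq hba hbd
  have hd : d ∈ S.cross (S.pivot d) := S.mem_cross_of_adj (S.adj_symm (S.adj_pivot d))
  have hinner : ∀ b ∈ S.cross a,
      entryOp K (b, d) (wordVec K l v : S.WordSpace K) = wordVec K ((b, d) :: l) v :=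
    fun b _ => entryOp_wordVec_of_not_clash fun y hy h => hcl y hy (h.congr_left hd)
  have hred : S.Reduced ((S.pivot a, d) :: l) v :=
    ⟨hpivot ▸ S.adj_symm (S.adj_pivot d), hs, hpivot ▸ hcl, hl⟩
  rw [Finset.sum_congr rfl fun b hb => congrArg (entryOp K (a, b)) (hinner b hb),
    ← Finset.add_sum_erase _ _ (S.mem_cross_of_adj (S.adj_pivot a)),
    entryOp_wordVec_of_clash hred rfl, sub_add_eq_add_sub, sub_eq_iff_eq_add]
  congr 1
  exact Finset.sum_congr rfl fun b hb => entryOp_wordVec_of_not_clash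
    (not_clash_of_ne_pivot (Finset.ne_of_mem_erase hb) d l)

theorem entryOp_entryOp_wordVec_of_clash [DecidableEq I] {a b d z : I} {l : List (I × I)} {v : V}
    (hl : S.Reduced ((d, z) :: l) v) (hd : d = S.pivot b) :
    entryOp K (a, b) (entryOp K (b, d) (wordVec K ((d, z) :: l) v : S.WordSpace K)) =
      (if b = z then entryOp K (a, z) (wordVec K l v) else 0) -
        ∑ d' ∈ (S.cross b).erase d,
          entryOp K (a, b) (entryOp K (b, d') (wordVec K ((d', z) :: l) v)) := by
  rw [entryOp_wordVec_of_clash hl hd, map_sub, map_sum]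
  congr 1
  · split_ifs with h
    · rw [h]
    · exact map_zero _
  · refine Finset.sum_congr rfl fun d' hd' => ?_
    rw [entryOp_wordVec_of_not_clash
      (not_clash_of_ne_pivot (hd ▸ Finset.ne_of_mem_erase hd') z l)]

/-- The overlap ambiguity: rewriting the last two entries of `(a, b), (b, d), (d, z)` instead of
the first two leads back to the case without a clash. -/
theorem sum_entryOp_entryOp_wordVec_of_clash [DecidableEq I] {a b d z : I} (hba : b ∈ S.cross a)
    (hbd : b ∈ S.cross d) {l : List (I × I)} {v : V} (hl : S.Reduced ((d, z) :: l) v)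
    (hd : d = S.pivot (S.pivot d)) :
    ∑ b ∈ S.cross a,
        entryOp K (a, b) (entryOp K (b, d) (wordVec K ((d, z) :: l) v : S.WordSpace K)) =
      if a = d then wordVec K ((d, z) :: l) v else 0 := by
  have hcross : S.cross a = S.cross d := S.cross_eq hba hbd
  have hpivot : ∀ b ∈ S.cross a, S.pivot b = d := fun b hb =>
    (S.pivot_eq (S.mem_cross_symm (hcross ▸ hb))
      (S.mem_cross_of_adj (S.adj_symm (S.adj_pivot d)))).trans hd.symm
  have hparallel : ∀ b' ∈ S.cross a, S.cross b' = S.cross b := fun b' hb' =>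
    S.cross_eq (S.mem_cross_symm hb') (S.mem_cross_symm hba)
  have hz : z ∈ S.cross a := hcross ▸ S.mem_cross_of_adj hl.1
  have hclear : ∀ d' ∈ (S.cross b).erase d, ∑ b ∈ S.cross a,
      entryOp K (a, b) (entryOp K (b, d') (wordVec K ((d', z) :: l) v : S.WordSpace K)) =
        if a = d' then wordVec K ((d', z) :: l) v else 0 := by
    intro d' hd'
    have hbd' : b ∈ S.cross d' := S.mem_cross_symm (Finset.mem_of_mem_erase hd')
    refine sum_entryOp_entryOp_wordVec_of_not_clash hba hbd' rfl (not_clash_of_ne_pivot ?_ z l)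
    rw [S.pivot_eq hbd' hbd, ← hd]
    exact Finset.ne_of_mem_erase hd'
  have hfirst : entryOp K (a, z) (wordVec K l v : S.WordSpace K) = wordVec K ((a, z) :: l) v :=
    entryOp_wordVec_of_not_clash fun y hy h =>
      hl.2.2.1 y hy (h.congr_left (S.mem_cross_of_adj hl.1))
  rw [Finset.sum_congr rfl fun b hb => entryOp_entryOp_wordVec_of_clash hl (hpivot b hb).symm,
    Finset.sum_sub_distrib, Finset.sum_ite_eq', if_pos hz, hfirst,
    Finset.sum_congr rfl fun b' hb' => by rw [hparallel b' hb'], Finset.sum_comm,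
    Finset.sum_congr rfl hclear, Finset.sum_ite_eq]
  by_cases had : a = d
  · simp [had]
  · rw [if_pos (Finset.mem_erase.2 ⟨had, S.mem_cross_symm hba⟩), sub_self, if_neg had]

theorem sum_entryOp_mul_entryOp [DecidableEq I] {a b d : I} (hba : b ∈ S.cross a)
    (hbd : b ∈ S.cross d) :
    ∑ b ∈ S.cross a, (entryOp K (a, b) * entryOp K (b, d) : Module.End K (S.WordSpace K)) =
      if a = d then vertexOp K (S.vtx a) else 0 := by
  refine wordSpace_hom_ext fun l v hl => ?_
  rw [LinearMap.sum_apply]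
  simp only [Module.End.mul_apply]
  by_cases hs : S.vtx d = S.wordSrc l v
  · have hright : (if a = d then vertexOp K (S.vtx a) else 0 : Module.End K (S.WordSpace K))
        (wordVec K l v) = if a = d then wordVec K l v else 0 := by
      split_ifs with had
      · exact vertexOp_wordVec_of_eq (had ▸ hs.symm)
      · rfl
    rw [hright]
    by_cases hcl : ∀ y ∈ l.head?, ¬ S.Clash (S.pivot d, d) y
    · exact sum_entryOp_entryOp_wordVec_of_not_clash hba hbd hs hcl
    · push Not at hcl
      obtain ⟨⟨_, z⟩, hy, rfl, hd⟩ := hcl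
      obtain ⟨l, rfl⟩ := List.head?_eq_some_iff.1 hy
      exact sum_entryOp_entryOp_wordVec_of_clash hba hbd hl hd
  · simp only [entryOp_wordVec_of_ne (x := (_, d)) hs, map_zero, Finset.sum_const_zero]
    split_ifs with had
    · rw [vertexOp_wordVec, if_neg fun h => hs (had ▸ h.symm)]
    · rfl

theorem isRealization_entryOp :
    S.IsRealization (vertexOp K : V → Module.End K (S.WordSpace K))
      fun a b => entryOp K (a, b) := by
  classical
  have hpivot (a : I) : S.pivot a ∈ S.cross a := S.mem_cross_of_adj (S.adj_pivot a)
  exact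
    { vertex_mul_self := vertexOp_mul_vertexOp_self
      vertex_mul_of_ne := vertexOp_mul_vertexOp_of_ne
      vertex_mul := vertexOp_mul_entryOp
      mul_vertex := entryOp_mul_vertexOp
      eq_zero := entryOp_eq_zero
      sum_mul_self := fun a => by rw [sum_entryOp_mul_entryOp (hpivot a) (hpivot a), if_pos rfl]
      sum_mul_of_ne := fun hba hbd h => by rw [sum_entryOp_mul_entryOp hba hbd, if_neg h] }

end Operators

variable {K A : Type*} [Field K]

section WordFiltration

variable (S) in
/-- The reduced words with at most `n` letters. -/
def reducedWords (n : ℕ) : Set (List (I × I) × V) := {w | S.Reduced w.1 w.2 ∧ w.1.length ≤ n}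

theorem finite_reducedWords [Finite V] [Finite I] (n : ℕ) : (S.reducedWords n).Finite :=
  ((List.finite_length_le (I × I) n).prod Set.finite_univ).subset fun _ hw => ⟨hw.2, trivial⟩

variable (S K) in
/-- The span of the reduced words with at most `n` letters in the space of words. -/
def wordFiltration (n : ℕ) : Submodule K (S.WordSpace K) :=
  Finsupp.supported K K {w | w.1.1.length ≤ n}

theorem wordVec_mem_wordFiltration {l : List (I × I)} {n : ℕ} (hl : l.length ≤ n) (v : V) :
    wordVec K l v ∈ S.wordFiltration K n := by
  rw [wordVec]
  split_ifs with h
  · exact Finsupp.single_mem_supported K 1 (show l.length ≤ n from hl)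
  · exact zero_mem _

theorem wordFiltration_le {n : ℕ} {N : Submodule K (S.WordSpace K)}
    (h : ∀ l v, S.Reduced l v → l.length ≤ n → wordVec K l v ∈ N) :
    S.wordFiltration K n ≤ N := by
  rw [wordFiltration, Finsupp.supported_eq_span_single, Submodule.span_le]
  rintro _ ⟨⟨⟨l, v⟩, hred⟩, hlen, rfl⟩
  simpa only [wordVec_of_reduced hred, SetLike.mem_coe] using h l v hred hlen

theorem wordFiltration_mono : Monotone (S.wordFiltration K) := fun _ _ hmn =>
  wordFiltration_le fun _ v _ hlen => wordVec_mem_wordFiltration (hlen.trans hmn) v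

theorem finrank_wordFiltration [Finite V] [Finite I] (n : ℕ) :
    Module.finrank K (S.wordFiltration K n) = (S.reducedWords n).ncard := by
  let words : Set {w : List (I × I) × V // S.Reduced w.1 w.2} := {w | w.1.1.length ≤ n}
  have himage : Subtype.val '' words = S.reducedWords n := by
    ext w
    simp [words, reducedWords, and_comm]
  have hfin : words.Finite :=
    Set.Finite.of_finite_image (himage ▸ finite_reducedWords n) Subtype.val_injective.injOn
  have := hfin.fintype
  rw [wordFiltration, ← himage, Set.ncard_image_of_injective _ Subtype.val_injective,
    (Finsupp.supportedEquivFinsupp words).finrank_eq, Module.finrank_finsupp_self,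
    ← Nat.card_eq_fintype_card, Nat.card_coe_set_eq]

instance finiteDimensional_wordFiltration [Finite V] [Finite I] (n : ℕ) :
    FiniteDimensional K (S.wordFiltration K n) := by
  have := (finite_reducedWords (S := S) n).to_subtype
  have hsub : S.wordFiltration K n ≤
      Submodule.span K (Set.range fun w : S.reducedWords n => wordVec K w.1.1 w.1.2) :=
    wordFiltration_le fun l v hl hlen => Submodule.subset_span ⟨⟨(l, v), hl, hlen⟩, rfl⟩
  have := FiniteDimensional.span_of_finite K (Set.finite_range
    fun w : S.reducedWords n => (wordVec K w.1.1 w.1.2 : S.WordSpace K))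
  exact Submodule.finiteDimensional_of_le hsub

theorem vertexOp_mem_wordFiltration (u : V) {n : ℕ} {w : S.WordSpace K}
    (hw : w ∈ S.wordFiltration K n) : vertexOp K u w ∈ S.wordFiltration K n := by
  suffices h : S.wordFiltration K n ≤ (S.wordFiltration K n).comap (vertexOp K u) from h hw
  refine wordFiltration_le fun l v _ hlen => ?_
  rw [Submodule.mem_comap, vertexOp_wordVec]
  split_ifs
  exacts [wordVec_mem_wordFiltration hlen v, zero_mem _]

theorem entryOp_mem_wordFiltration (x : I × I) {n : ℕ} {w : S.WordSpace K}
    (hw : w ∈ S.wordFiltration K n) : entryOp K x w ∈ S.wordFiltration K (n + 1) := by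
  suffices h : S.wordFiltration K n ≤ (S.wordFiltration K (n + 1)).comap (entryOp K x) from h hw
  refine wordFiltration_le fun l v hred hlen => ?_
  rw [Submodule.mem_comap, entryOp_wordVec hred]
  cases l with
  | nil => exact wordVec_mem_wordFiltration (Nat.succ_le_succ hlen) v
  | cons y l =>
    rw [List.length_cons] at hlen
    simp only [entryMul]
    split_ifs
    · exact sub_mem (wordVec_mem_wordFiltration (by omega) v)
        (sum_mem fun _ _ => wordVec_mem_wordFiltration (by simpa using hlen) v)
    · exact sub_mem (zero_mem _)
        (sum_mem fun _ _ => wordVec_mem_wordFiltration (by simpa using hlen) v)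
    · exact wordVec_mem_wordFiltration (by simpa using hlen) v

end WordFiltration

section Realization

variable [NonUnitalRing A]

/-- The value of a word in the ring that contains the elements `p v` and `x a b`. -/
def monomial (p : V → A) (x : I → I → A) : List (I × I) → V → A
  | [], v => p v
  | y :: l, v => x y.1 y.2 * monomial p x l v

variable [Module K A] {p : V → A} {x : I → I → A}

variable (S K) in
/-- The linear map that sends a reduced word to its value. -/
noncomputable def wordMap (p : V → A) (x : I → I → A) : S.WordSpace K →ₗ[K] A :=
  Finsupp.linearCombination K fun w => monomial p x w.1.1 w.1.2

theorem wordMap_wordVec {l : List (I × I)} {v : V} (h : S.Reduced l v) :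
    wordMap S K p x (wordVec K l v) = monomial p x l v := by
  simp [wordMap, wordVec_of_reduced h]

variable (S K) in
/-- The span of the values of the reduced words with at most `n` letters. -/
noncomputable def wordSpan (p : V → A) (x : I → I → A) (n : ℕ) : Submodule K A :=
  (S.wordFiltration K n).map (wordMap S K p x)

theorem wordSpan_mono : Monotone (wordSpan S K p x) := fun _ _ hmn =>
  Submodule.map_mono (wordFiltration_mono hmn)

namespace IsRealization

theorem vertex_mul_monomial (h : S.IsRealization p x) (l : List (I × I)) (v : V) :
    p (S.wordSrc l v) * monomial p x l v = monomial p x l v := by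
  cases l with
  | nil => exact h.vertex_mul_self v
  | cons y l => rw [monomial, ← mul_assoc, wordSrc, h.vertex_mul]

theorem vertex_mul_monomial_of_ne (h : S.IsRealization p x) {u : V} {l : List (I × I)} {v : V}
    (hu : u ≠ S.wordSrc l v) : p u * monomial p x l v = 0 := by
  rw [← h.vertex_mul_monomial l v, ← mul_assoc, h.vertex_mul_of_ne hu, zero_mul]

theorem wordMap_vertexOp (h : S.IsRealization p x) (u : V) {l : List (I × I)} {v : V}
    (hl : S.Reduced l v) :
    wordMap S K p x (vertexOp K u (wordVec K l v)) = p u * wordMap S K p x (wordVec K l v) := by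
  rw [vertexOp_wordVec, wordMap_wordVec hl]
  split_ifs with hu
  · rw [wordMap_wordVec hl, ← hu, h.vertex_mul_monomial]
  · rw [map_zero, h.vertex_mul_monomial_of_ne (Ne.symm hu)]

theorem wordMap_wordVec_cons (h : S.IsRealization p x) {a b : I} {l : List (I × I)} {v : V}
    (hcl : ∀ y ∈ l.head?, ¬ S.Clash (a, b) y) :
    wordMap S K p x (wordVec K ((a, b) :: l) v) = x a b * wordMap S K p x (wordVec K l v) := by
  by_cases hl : S.Reduced l v
  swap
  · rw [wordVec_cons_of_not_reduced hl, wordVec_of_not_reduced hl, map_zero, mul_zero]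
  rw [wordMap_wordVec hl]
  by_cases hab : S.Adj a b ∧ S.vtx b = S.wordSrc l v
  · exact wordMap_wordVec ⟨hab.1, hab.2, hcl, hl⟩
  rw [wordVec_of_not_reduced fun hl' : S.Reduced ((a, b) :: l) v => hab ⟨hl'.1, hl'.2.1⟩, map_zero]
  rcases not_and_or.1 hab with hadj | hvtx
  · rw [h.eq_zero hadj, zero_mul]
  · rw [← h.mul_vertex, mul_assoc, h.vertex_mul_monomial_of_ne hvtx, mul_zero]

theorem sum_mul_mul [DecidableEq I] (h : S.IsRealization p x) {a b d : I} (hba : b ∈ S.cross a)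
    (hbd : b ∈ S.cross d) {m : A} (hm : p (S.vtx d) * m = m) :
    ∑ b ∈ S.cross a, x a b * (x b d * m) = if a = d then m else 0 := by
  simp only [← mul_assoc]
  rw [← Finset.sum_mul]
  split_ifs with had
  · subst had
    rw [h.sum_mul_self, hm]
  · rw [h.sum_mul_of_ne hba hbd had, zero_mul]

theorem wordMap_entryOp (h : S.IsRealization p x) (a b : I) {l : List (I × I)} {v : V}
    (hl : S.Reduced l v) : wordMap S K p x (entryOp K (a, b) (wordVec K l v)) =
      x a b * wordMap S K p x (wordVec K l v) := by
  classical
  by_cases hcl : ∀ y ∈ l.head?, ¬ S.Clash (a, b) y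
  · rw [entryOp_wordVec_of_not_clash hcl, h.wordMap_wordVec_cons hcl]
  push Not at hcl
  obtain ⟨⟨_, d⟩, hy, rfl, hb⟩ := hcl
  obtain ⟨l, rfl⟩ := List.head?_eq_some_iff.1 hy
  dsimp only at hb hl ⊢
  have hba : b ∈ S.cross a := hb ▸ S.mem_cross_of_adj (S.adj_pivot a)
  have hbd : b ∈ S.cross d := S.mem_cross_symm (S.mem_cross_of_adj hl.1)
  have hm : p (S.vtx d) * monomial p x l v = monomial p x l v :=
    (show S.vtx d = _ from hl.2.1) ▸ h.vertex_mul_monomial l v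
  have hterm : ∀ b' ∈ (S.cross a).erase b,
      wordMap S K p x (wordVec K ((a, b') :: (b', d) :: l) v) =
        x a b' * (x b' d * monomial p x l v) := by
    intro b' hb'
    have hne : b' ≠ b := Finset.ne_of_mem_erase hb'
    have hab' : ∀ y ∈ ((b', d) :: l).head?, ¬ S.Clash (a, b') y :=
      not_clash_of_ne_pivot (hb ▸ hne) d l
    have hb'd : ∀ y ∈ l.head?, ¬ S.Clash (b', d) y := fun y hy hcl =>
      hl.2.2.1 y hy (hcl.congr_left (S.mem_cross_of_adj hl.1))
    rw [h.wordMap_wordVec_cons hab', h.wordMap_wordVec_cons hb'd, wordMap_wordVec hl.2.2.2]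
  rw [entryOp_wordVec_of_clash hl hb, map_sub, map_sum, Finset.sum_congr rfl hterm,
    wordMap_wordVec hl, monomial, sub_eq_iff_eq_add,
    Finset.add_sum_erase _ (fun b => x a b * (x b d * monomial p x l v)) hba,
    h.sum_mul_mul hba hbd hm]
  split_ifs
  · exact wordMap_wordVec hl.2.2.2
  · exact map_zero _

theorem entry_mem_wordSpan (h : S.IsRealization p x) (a b : I) : x a b ∈ wordSpan S K p x 1 := by
  refine ⟨_, entryOp_mem_wordFiltration (a, b)
    (wordVec_mem_wordFiltration (l := []) le_rfl (S.vtx b)), ?_⟩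
  rw [h.wordMap_entryOp a b (l := []) trivial, wordMap_wordVec (l := []) trivial, monomial,
    h.mul_vertex]

end IsRealization

theorem monomial_mem_wordSpan {l : List (I × I)} {v : V} (hl : S.Reduced l v) {n : ℕ}
    (hlen : l.length ≤ n) : monomial p x l v ∈ wordSpan S K p x n :=
  ⟨_, wordVec_mem_wordFiltration hlen v, wordMap_wordVec hl⟩

variable (S K) in
theorem vertex_mem_wordSpan (v : V) (n : ℕ) : p v ∈ wordSpan S K p x n :=
  monomial_mem_wordSpan (l := []) trivial n.zero_le

namespace IsRealization

variable [SMulCommClass K A A]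

theorem vertex_mul_mem_wordSpan (h : S.IsRealization p x) (u : V) {n : ℕ} {z : A}
    (hz : z ∈ wordSpan S K p x n) : p u * z ∈ wordSpan S K p x n := by
  have hcomm : wordMap S K p x ∘ₗ vertexOp K u = LinearMap.mulLeft K (p u) ∘ₗ wordMap S K p x :=
    wordSpace_hom_ext fun l v hl => h.wordMap_vertexOp u hl
  obtain ⟨w, hw, rfl⟩ := hz
  exact ⟨_, vertexOp_mem_wordFiltration u hw, LinearMap.congr_fun hcomm w⟩

theorem entry_mul_mem_wordSpan (h : S.IsRealization p x) (a b : I) {n : ℕ} {z : A}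
    (hz : z ∈ wordSpan S K p x n) : x a b * z ∈ wordSpan S K p x (n + 1) := by
  have hcomm : wordMap S K p x ∘ₗ entryOp K (a, b) =
      LinearMap.mulLeft K (x a b) ∘ₗ wordMap S K p x :=
    wordSpace_hom_ext fun l v hl => h.wordMap_entryOp a b hl
  obtain ⟨w, hw, rfl⟩ := hz
  exact ⟨_, entryOp_mem_wordFiltration (a, b) hw, LinearMap.congr_fun hcomm w⟩

theorem monomial_mul_mem_wordSpan (h : S.IsRealization p x) (l : List (I × I)) (v : V) {n : ℕ}
    {z : A} (hz : z ∈ wordSpan S K p x n) :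
    monomial p x l v * z ∈ wordSpan S K p x (l.length + n) := by
  induction l with
  | nil => exact (Nat.zero_add n).symm ▸ h.vertex_mul_mem_wordSpan v hz
  | cons y l ih =>
    rw [monomial, mul_assoc, List.length_cons, Nat.add_right_comm]
    exact h.entry_mul_mem_wordSpan _ _ ih

variable [IsScalarTower K A A]

theorem mul_mem_wordSpan (h : S.IsRealization p x) {m n : ℕ} {y z : A}
    (hy : y ∈ wordSpan S K p x m) (hz : z ∈ wordSpan S K p x n) :
    y * z ∈ wordSpan S K p x (m + n) := by
  suffices hle : S.wordFiltration K m ≤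
      (wordSpan S K p x (m + n)).comap (LinearMap.mulRight K z ∘ₗ wordMap S K p x) by
    obtain ⟨w, hw, rfl⟩ := hy
    exact hle hw
  refine wordFiltration_le fun l v hl hlen => ?_
  rw [Submodule.mem_comap, LinearMap.comp_apply, wordMap_wordVec hl, LinearMap.mulRight_apply]
  exact wordSpan_mono (Nat.add_le_add_right hlen n) (h.monomial_mul_mem_wordSpan l v hz)

theorem exists_mem_wordSpan (h : S.IsRealization p x)
    (hgen : NonUnitalAlgebra.adjoin K (Set.range p ∪ Set.range (Function.uncurry x)) = ⊤)
    (z : A) : ∃ n, z ∈ wordSpan S K p x n := by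
  have hz : z ∈ NonUnitalAlgebra.adjoin K (Set.range p ∪ Set.range (Function.uncurry x)) :=
    hgen ▸ NonUnitalAlgebra.mem_top
  induction hz using NonUnitalAlgebra.adjoin_induction with
  | mem z hz =>
    obtain ⟨v, rfl⟩ | ⟨⟨a, b⟩, rfl⟩ := hz
    exacts [⟨0, vertex_mem_wordSpan S K v 0⟩, ⟨1, h.entry_mem_wordSpan a b⟩]
  | add y z _ _ hy hz =>
    obtain ⟨m, hm⟩ := hy
    obtain ⟨n, hn⟩ := hz
    exact ⟨max m n, add_mem (wordSpan_mono (le_max_left m n) hm)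
      (wordSpan_mono (le_max_right m n) hn)⟩
  | zero => exact ⟨0, zero_mem _⟩
  | mul y z _ _ hy hz =>
    obtain ⟨m, hm⟩ := hy
    obtain ⟨n, hn⟩ := hz
    exact ⟨m + n, h.mul_mem_wordSpan hm hn⟩
  | smul k z _ hz =>
    obtain ⟨n, hn⟩ := hz
    exact ⟨n, Submodule.smul_mem _ k hn⟩

theorem monomial_mem_growthSpace (h : S.IsRealization p x) {l : List (I × I)} {v : V}
    (hl : S.Reduced l v) {n : ℕ} (hn : 1 ≤ n) (hlen : l.length ≤ n) :
    monomial p x l v ∈ growthSpace (wordSpan S K p x 1) n := by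
  induction l generalizing n with
  | nil => exact le_growthSpace _ hn (vertex_mem_wordSpan S K v 1)
  | cons y l ih =>
    obtain hle | hlt := hn.eq_or_lt'
    · exact le_growthSpace _ hn (hle ▸ monomial_mem_wordSpan hl hlen)
    · rw [List.length_cons] at hlen
      obtain ⟨m, rfl⟩ := Nat.exists_eq_add_of_le hn
      exact mul_mem_growthSpace (le_growthSpace _ le_rfl (h.entry_mem_wordSpan _ _))
        (ih hl.2.2.2 (by omega) (by omega))

theorem growthSpace_wordSpan (h : S.IsRealization p x) {n : ℕ} (hn : 1 ≤ n) :
    growthSpace (wordSpan S K p x 1) n = wordSpan S K p x n := by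
  refine le_antisymm (growthSpace_le wordSpan_mono le_rfl
    (fun _ _ hy _ hz => h.mul_mem_wordSpan hy hz) n) ?_
  refine Submodule.map_le_iff_le_comap.2 (wordFiltration_le fun l v hl hlen => ?_)
  rw [Submodule.mem_comap, wordMap_wordVec hl]
  exact h.monomial_mem_growthSpace hl hn hlen

theorem isGeneratingSpace_wordSpan [Finite V] [Finite I] (h : S.IsRealization p x)
    (hgen : NonUnitalAlgebra.adjoin K (Set.range p ∪ Set.range (Function.uncurry x)) = ⊤) :
    IsGeneratingSpace (wordSpan S K p x 1) := by
  refine ⟨Module.Finite.map _ _, fun z => ?_⟩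
  obtain ⟨n, hn⟩ := h.exists_mem_wordSpan hgen z
  refine ⟨n + 1, ?_⟩
  rw [h.growthSpace_wordSpan (Nat.le_add_left 1 n)]
  exact wordSpan_mono n.le_succ hn

theorem growthFun_wordSpan [Finite V] [Finite I] (h : S.IsRealization p x)
    (hinj : Function.Injective (wordMap S K p x)) {n : ℕ} (hn : 1 ≤ n) :
    growthFun (wordSpan S K p x 1) n = (S.reducedWords n).ncard := by
  rw [growthFun, h.growthSpace_wordSpan hn, wordSpan,
    ← (Submodule.equivMapOfInjective _ hinj _).finrank_eq, finrank_wordFiltration]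

end IsRealization

theorem map_monomial_sum_wordVec [Fintype V] {φ : A →ₙₐ[K] Module.End K (S.WordSpace K)}
    (hp : ∀ u, φ (p u) = vertexOp K u) (hx : ∀ a b, φ (x a b) = entryOp K (a, b))
    {l : List (I × I)} {v : V} (hl : S.Reduced l v) :
    φ (monomial p x l v) (∑ u, wordVec K [] u) = wordVec K l v := by
  induction l with
  | nil =>
    rw [monomial, hp, map_sum, Finset.sum_eq_single v]
    · exact vertexOp_wordVec_of_eq rfl
    · exact fun u _ hu => (vertexOp_wordVec v [] u).trans (if_neg hu)
    · exact fun hv => (hv (Finset.mem_univ v)).elim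
  | cons y l ih =>
    rw [monomial, map_mul, Module.End.mul_apply, ih hl.2.2.2, hx,
      entryOp_wordVec_of_not_clash hl.2.2.1]

theorem wordMap_injective [Finite V] {φ : A →ₙₐ[K] Module.End K (S.WordSpace K)}
    (hp : ∀ u, φ (p u) = vertexOp K u) (hx : ∀ a b, φ (x a b) = entryOp K (a, b)) :
    Function.Injective (wordMap S K p x) := by
  have := Fintype.ofFinite V
  have hleft : LinearMap.applyₗ (∑ u, wordVec K [] u) ∘ₗ
      (φ : A →ₗ[K] Module.End K (S.WordSpace K)) ∘ₗ wordMap S K p x = LinearMap.id := by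
    refine wordSpace_hom_ext fun l v hl => ?_
    rw [LinearMap.comp_apply, LinearMap.comp_apply, wordMap_wordVec hl]
    exact map_monomial_sum_wordVec hp hx hl
  exact Function.LeftInverse.injective (g := fun z => φ z (∑ u, wordVec K [] u)) fun w =>
    LinearMap.congr_fun hleft w

end Realization

end MatrixPattern

/-! ### Generators and relations -/

namespace AlgQuot

variable {K A B : Type*} [CommRing K] [NonUnitalRing A] [Module K A]
  [NonUnitalRing B] [Module K B] {r : A → A → Prop}

theorem map_eq_of_algConGen {f : A →ₙₐ[K] B} (h : ∀ a b, r a b → f a = f b) {x y : A}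
    (hxy : algConGen K r x y) : f x = f y := by
  induction (hxy : RingConGen.Rel _ x y) with
  | of x y hxy =>
    obtain ⟨c, a, b, hr, rfl, rfl⟩ := hxy
    rw [map_smul, map_smul, h a b hr]
  | refl x => rfl
  | symm _ ih => exact ih.symm
  | trans _ _ ih₁ ih₂ => exact ih₁.trans ih₂
  | add _ _ ih₁ ih₂ => rw [map_add, map_add, ih₁, ih₂]
  | mul _ _ ih₁ ih₂ => rw [map_mul, map_mul, ih₁, ih₂]

variable [IsScalarTower K A A]

variable (K r) in
/-- The quotient map as a homomorphism of `K`-algebras. -/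
def mkHom : A →ₙₐ[K] AlgQuot K r where
  toFun := mk K r
  map_zero' := rfl
  map_add' _ _ := rfl
  map_mul' _ _ := rfl
  map_smul' _ _ := rfl

theorem mkHom_surjective : Function.Surjective (mkHom K r) := mk_surjective K r

theorem mkHom_eq_of_rel {a b : A} (h : r a b) : mkHom K r a = mkHom K r b :=
  Quotient.sound' (RingConGen.Rel.of _ _ ⟨1, a, b, h, (one_smul K a).symm, (one_smul K b).symm⟩)

/-- The homomorphism on the quotient induced by a homomorphism that respects the relations. -/
def lift (f : A →ₙₐ[K] B) (h : ∀ a b, r a b → f a = f b) : AlgQuot K r →ₙₐ[K] B where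
  toFun := Quotient.lift f fun _ _ hxy => map_eq_of_algConGen h hxy
  map_zero' := map_zero f
  map_add' x y := by
    obtain ⟨a, rfl⟩ := mk_surjective K r x
    obtain ⟨b, rfl⟩ := mk_surjective K r y
    exact map_add f a b
  map_mul' x y := by
    obtain ⟨a, rfl⟩ := mk_surjective K r x
    obtain ⟨b, rfl⟩ := mk_surjective K r y
    exact map_mul f a b
  map_smul' k x := by
    obtain ⟨a, rfl⟩ := mk_surjective K r x
    exact map_smul f k a

end AlgQuot

namespace FreeNUAlgebra

variable {K X : Type*} [CommRing K]

theorem adjoin_range_gen :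
    NonUnitalAlgebra.adjoin K (Set.range (gen K : X → FreeNUAlgebra K X)) = ⊤ := by
  refine NonUnitalAlgebra.eq_top_iff.2 fun f => ?_
  have hword : ∀ w : FreeSemigroup X, (MonoidAlgebra.single w 1 : FreeNUAlgebra K X) ∈
      NonUnitalAlgebra.adjoin K (Set.range (gen K : X → FreeNUAlgebra K X)) := by
    intro w
    induction w using FreeSemigroup.recOnMul with
    | ih1 x => exact NonUnitalAlgebra.subset_adjoin K (Set.mem_range_self x)
    | ih2 x y hx hy => simpa [MonoidAlgebra.single_mul_single] using mul_mem hx hy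
  induction f using MonoidAlgebra.induction_linear with
  | zero => exact zero_mem _
  | add f g hf hg => exact add_mem hf hg
  | single w k => simpa [MonoidAlgebra.smul_single] using SMulMemClass.smul_mem k (hword w)

variable {B : Type*} [NonUnitalRing B] [Module K B] [IsScalarTower K B B] [SMulCommClass K B B]

/-- The homomorphism on the free algebra with given values at the generators. -/
noncomputable def lift (f : X → B) : FreeNUAlgebra K X →ₙₐ[K] B :=
  MonoidAlgebra.liftMagma K (FreeSemigroup.lift f)

theorem lift_gen (f : X → B) (x : X) : lift f (gen K x) = f x := by
  simp [lift, gen]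

end FreeNUAlgebra

theorem AlgQuot.adjoin_range_mkHom_gen {K X : Type*} [CommRing K]
    (r : FreeNUAlgebra K X → FreeNUAlgebra K X → Prop) :
    NonUnitalAlgebra.adjoin K (Set.range fun x => mkHom K r (FreeNUAlgebra.gen K x)) = ⊤ := by
  rw [Set.range_comp' (mkHom K r), ← NonUnitalAlgHom.map_adjoin, FreeNUAlgebra.adjoin_range_gen,
    NonUnitalAlgebra.map_top, NonUnitalAlgebra.range_eq_top]
  exact mkHom_surjective

/-! ### Weighted Leavitt path algebras -/

namespace WeightedGraph

open MatrixPattern FreeNUAlgebra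

variable {V E : Type*} [Fintype E]

/-- The rows `(v, i)` with `i < w(v)` and the columns `e` of the matrices `(e_i)` of the regular
vertices. -/
abbrev Index (G : WeightedGraph V E) : Type _ := (Σ v, Fin (G.vertexWeight v)) ⊕ E

variable {G : WeightedGraph V E}

theorem mem_emitted {v : V} {e : E} : e ∈ G.emitted v ↔ G.src e = v := by
  simp [emitted]

theorem weight_le_vertexWeight (e : E) : G.weight e ≤ G.vertexWeight (G.src e) :=
  Finset.le_sup (mem_emitted.2 rfl)

theorem isRegular_of_vertexWeight_pos {v : V} (h : 0 < G.vertexWeight v) : G.IsRegular v := by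
  obtain ⟨e, he, -⟩ := Finset.lt_sup_iff.1 h
  exact ⟨e, mem_emitted.1 he⟩

variable (G) in
/-- The row of the entry `e_i`. -/
noncomputable def row (x : G.HatEdge) : G.Index :=
  Sum.inl ⟨G.src x.1, x.2.castLE (weight_le_vertexWeight x.1)⟩

theorem row_eq_row_iff {x y : G.HatEdge} :
    row G x = row G y ↔ G.src x.1 = G.src y.1 ∧ (x.2 : ℕ) = y.2 := by
  rw [row, row, Sum.inl.injEq, Sigma.ext_iff]
  refine and_congr_right fun h => ?_
  rw [Fin.heq_ext_iff (congrArg _ h)]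
  rfl

variable (G) in
/-- The edge `e_i` is the entry in row `i` and column `e`, and `e_i*` is the transposed entry. -/
noncomputable def toEntry : G.DEdge → G.Index × G.Index :=
  Sum.elim (fun x => (row G x, Sum.inr x.1)) fun x => (Sum.inr x.1, row G x)

theorem toEntry_injective : Function.Injective G.toEntry := by
  rintro (⟨e, i⟩ | ⟨e, i⟩) (⟨f, j⟩ | ⟨f, j⟩) h
  · obtain ⟨h, he⟩ := Prod.mk.inj h
    obtain rfl := Sum.inr_injective he
    obtain rfl : i = j := Fin.ext (row_eq_row_iff.1 h).2
    rfl
  · exact absurd (Prod.mk.inj h).1 Sum.inl_ne_inr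
  · exact absurd (Prod.mk.inj h).1 Sum.inr_ne_inl
  · obtain ⟨he, h⟩ := Prod.mk.inj h
    obtain rfl := Sum.inr_injective he
    obtain rfl : i = j := Fin.ext (row_eq_row_iff.1 h).2
    rfl

theorem toEntry_range_symm {a b : G.Index} :
    (a, b) ∈ Set.range G.toEntry → (b, a) ∈ Set.range G.toEntry := by
  rintro ⟨x | x, h⟩ <;> obtain ⟨rfl, rfl⟩ := Prod.mk.inj h
  exacts [⟨.inr x, rfl⟩, ⟨.inl x, rfl⟩]

theorem lt_weight_of_mem_range_toEntry {a : Σ v, Fin (G.vertexWeight v)} {e : E}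
    (h : (.inl a, .inr e) ∈ Set.range G.toEntry) : a.2 < G.weight e := by
  obtain ⟨⟨f, i⟩ | x, h⟩ := h
  · obtain ⟨hrow, hcol⟩ := Prod.mk.inj h
    obtain rfl := Sum.inr_injective hcol
    obtain rfl := Sum.inl_injective hrow
    exact i.2
  · exact absurd (Prod.mk.inj h).1 Sum.inr_ne_inl

/-- The columns that meet a row, and the rows that meet a column. -/
noncomputable def crossing : G.Index → Finset G.Index :=
  Sum.elim (fun a => (G.emitted a.1).map .inr)
    fun e => Finset.univ.map ((Function.Embedding.sigmaMk (G.src e)).trans .inl)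

theorem inr_mem_crossing {a : Σ v, Fin (G.vertexWeight v)} {e : E} :
    .inr e ∈ crossing (G := G) (.inl a) ↔ G.src e = a.1 := by
  simp [crossing, mem_emitted]

theorem inl_mem_crossing {a : Σ v, Fin (G.vertexWeight v)} {e : E} :
    .inl a ∈ crossing (G := G) (.inr e) ↔ G.src e = a.1 := by
  obtain ⟨v, i⟩ := a
  simp only [crossing, Sum.elim_inr, Finset.mem_map, Finset.mem_univ, true_and]
  constructor
  · rintro ⟨i, h⟩
    exact congrArg Sigma.fst (Sum.inl_injective h)
  · rintro rfl
    exact ⟨i, rfl⟩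

theorem inl_notMem_crossing (a b : Σ v, Fin (G.vertexWeight v)) :
    .inl b ∉ crossing (G := G) (.inl a) := by
  simp [crossing]

theorem inr_notMem_crossing (e f : E) : .inr f ∉ crossing (G := G) (.inr e) := by
  simp [crossing]

/-- The pattern of the matrices `(e_i)`. The pivots are the column `e^v` and the row `1`, so that
the products through the pivots are the forbidden words. -/
noncomputable def SpecialEdges.pattern (c : G.SpecialEdges) : MatrixPattern V G.Index where
  vtx := Sum.elim Sigma.fst G.rng
  cross := crossing
  pivot := Sum.elim (fun a => .inr (c.edge a.1 (isRegular_of_vertexWeight_pos a.2.pos)))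
    fun e => row G ⟨e, 0, G.weight_pos e⟩
  Adj a b := (a, b) ∈ Set.range G.toEntry
  adj_symm := toEntry_range_symm
  mem_cross_of_adj := by
    rintro a b ⟨x | x, h⟩ <;> obtain ⟨rfl, rfl⟩ := Prod.mk.inj h
    exacts [inr_mem_crossing.2 rfl, inl_mem_crossing.2 rfl]
  mem_cross_symm := by
    rintro (a | e) (b | f) h <;>
      simp_all only [inl_mem_crossing, inr_mem_crossing, inl_notMem_crossing, inr_notMem_crossing]
  cross_eq := by
    rintro (a | e) (b | b) (d | f) ha hd <;>
      simp only [inl_mem_crossing, inr_mem_crossing, inl_notMem_crossing,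
        inr_notMem_crossing] at ha hd
    · exact congrArg (fun v => (G.emitted v).map .inr) (ha.symm.trans hd)
    · exact congrArg
        (fun v => Finset.univ.map ((Function.Embedding.sigmaMk v).trans Function.Embedding.inl))
        (ha.trans hd.symm)
  pivot_eq := by
    rintro (⟨v, i⟩ | e) (b | b) (⟨w, j⟩ | f) ha hd <;>
      simp only [inl_mem_crossing, inr_mem_crossing, inl_notMem_crossing,
        inr_notMem_crossing] at ha hd
    · obtain rfl : v = w := ha.symm.trans hd
      rfl
    · exact row_eq_row_iff.2 ⟨ha.trans hd.symm, rfl⟩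
  adj_pivot := by
    rintro (⟨v, i⟩ | e)
    · have hv := isRegular_of_vertexWeight_pos i.pos
      refine ⟨.inl ⟨c.edge v hv, i.cast (c.weight_edge v hv).symm⟩, ?_⟩
      refine Prod.ext (congrArg Sum.inl (Sigma.ext (c.src_edge v hv) ?_)) rfl
      simp [Fin.heq_ext_iff, c.src_edge]
    · exact ⟨.inr ⟨e, 0, G.weight_pos e⟩, rfl⟩

variable (c : G.SpecialEdges)

theorem vtx_toEntry_fst (x : G.DEdge) : c.pattern.vtx (G.toEntry x).1 = G.hat.double.src x := by
  rcases x with x | x <;> rfl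

theorem vtx_toEntry_snd (x : G.DEdge) : c.pattern.vtx (G.toEntry x).2 = G.hat.double.rng x := by
  rcases x with x | x <;> rfl

section Realization

variable {K A : Type*} [CommRing K] [NonUnitalRing A] [Module K A]
  (φ : FreeNUAlgebra K G.Letter →ₙₐ[K] A)

/-- The matrix entries in `A` given by the images of the edges; all other entries are `0`. -/
noncomputable def entryMap (a b : G.Index) : A :=
  Function.extend G.toEntry (fun x => φ (gen K (.inr x))) 0 (a, b)

theorem entryMap_toEntry (x : G.DEdge) :
    entryMap φ (G.toEntry x).1 (G.toEntry x).2 = φ (gen K (.inr x)) :=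
  toEntry_injective.extend_apply _ _ x

theorem entryMap_eq_zero {a b : G.Index} (h : (a, b) ∉ Set.range G.toEntry) :
    entryMap φ a b = 0 :=
  Function.extend_apply' _ _ _ h

theorem entryMap_inl_inr {a : Σ v, Fin (G.vertexWeight v)} {e : E} (h : G.src e = a.1) :
    entryMap φ (.inl a) (.inr e) = φ (G.realElt K e a.2) := by
  obtain ⟨_, i⟩ := a
  subst h
  rw [realElt]
  split_ifs with hi
  · exact entryMap_toEntry φ (.inl ⟨e, i, hi⟩)
  · rw [map_zero, entryMap_eq_zero φ fun h => hi (lt_weight_of_mem_range_toEntry h)]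

theorem entryMap_inr_inl {a : Σ v, Fin (G.vertexWeight v)} {e : E} (h : G.src e = a.1) :
    entryMap φ (.inr e) (.inl a) = φ (G.ghostElt K e a.2) := by
  obtain ⟨_, i⟩ := a
  subst h
  rw [ghostElt]
  split_ifs with hi
  · exact entryMap_toEntry φ (.inr ⟨e, i, hi⟩)
  · rw [map_zero, entryMap_eq_zero φ fun h =>
      hi (lt_weight_of_mem_range_toEntry (toEntry_range_symm h))]

theorem map_sum_real_ghost {a d : Σ v, Fin (G.vertexWeight v)} (h : a.1 = d.1) :
    φ (∑ e ∈ G.emitted a.1, G.realElt K e a.2 * G.ghostElt K e d.2) =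
      ∑ b ∈ crossing (.inl a), entryMap φ (.inl a) b * entryMap φ b (.inl d) := by
  rw [map_sum, crossing, Sum.elim_inl, Finset.sum_map]
  refine Finset.sum_congr rfl fun e he => ?_
  have he := mem_emitted.1 he
  rw [map_mul, ← entryMap_inl_inr φ he, ← entryMap_inr_inl φ (he.trans h)]
  rfl

theorem map_sum_ghost_real {e f : E} (h : G.src e = G.src f) :
    φ (∑ i ∈ Finset.range (G.vertexWeight (G.src e)), G.ghostElt K e i * G.realElt K f i) =
      ∑ b ∈ crossing (.inr e), entryMap φ (.inr e) b * entryMap φ b (.inr f) := by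
  rw [map_sum, crossing, Sum.elim_inr, Finset.sum_map, Finset.sum_range]
  refine Finset.sum_congr rfl fun i _ => ?_
  rw [map_mul, ← entryMap_inr_inl φ (a := ⟨_, i⟩) rfl,
    ← entryMap_inl_inr φ (a := ⟨G.src e, i⟩) h.symm]
  rfl

theorem map_entryMap {B : Type*} [NonUnitalRing B] [Module K B] (ψ : A →ₙₐ[K] B)
    (a b : G.Index) : ψ (entryMap φ a b) = entryMap (ψ.comp φ) a b := by
  by_cases hab : (a, b) ∈ Set.range G.toEntry
  · obtain ⟨x, hx⟩ := hab
    obtain ⟨rfl, rfl⟩ : (G.toEntry x).1 = a ∧ (G.toEntry x).2 = b := Prod.ext_iff.1 hx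
    rw [entryMap_toEntry, entryMap_toEntry]
    rfl
  · rw [entryMap_eq_zero _ hab, entryMap_eq_zero _ hab, map_zero]

variable {φ}

theorem isRealization_entryMap (h : ∀ a b, G.LeavittRel K a b → φ a = φ b) :
    c.pattern.IsRealization (fun v => φ (gen K (.inl v))) (entryMap φ) where
  vertex_mul_self u := by simpa using h _ _ (.path (.vertex u u))
  vertex_mul_of_ne {u v} huv := by simpa [huv] using h _ _ (.path (.vertex u v))
  vertex_mul a b := by
    by_cases hab : (a, b) ∈ Set.range G.toEntry
    · obtain ⟨x, hx⟩ := hab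
      obtain ⟨rfl, rfl⟩ : (G.toEntry x).1 = a ∧ (G.toEntry x).2 = b := Prod.ext_iff.1 hx
      rw [entryMap_toEntry, vtx_toEntry_fst, ← map_mul, h _ _ (.path (.src x))]
    · rw [entryMap_eq_zero φ hab, mul_zero]
  mul_vertex a b := by
    by_cases hab : (a, b) ∈ Set.range G.toEntry
    · obtain ⟨x, hx⟩ := hab
      obtain ⟨rfl, rfl⟩ : (G.toEntry x).1 = a ∧ (G.toEntry x).2 = b := Prod.ext_iff.1 hx
      rw [entryMap_toEntry, vtx_toEntry_snd, ← map_mul, h _ _ (.path (.rng x))]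
    · rw [entryMap_eq_zero φ hab, zero_mul]
  eq_zero := entryMap_eq_zero φ
  sum_mul_self := by
    rintro (⟨v, i⟩ | e)
    · refine (map_sum_real_ghost φ rfl).symm.trans ((h _ _ (.real_ghost v
        (isRegular_of_vertexWeight_pos i.pos) i i i.2 i.2)).trans ?_)
      rw [if_pos rfl]
      rfl
    · refine (map_sum_ghost_real φ rfl).symm.trans ((h _ _ (.ghost_real _ ⟨e, rfl⟩ e e rfl
        rfl)).trans ?_)
      rw [if_pos rfl]
      rfl
  sum_mul_of_ne := by
    rintro (⟨v, i⟩ | e) (b | b) (⟨w, j⟩ | f) ha hd hne <;>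
      simp only [SpecialEdges.pattern, inl_mem_crossing, inr_mem_crossing, inl_notMem_crossing,
        inr_notMem_crossing] at ha hd
    · obtain rfl : v = w := ha.symm.trans hd
      have hij : (i : ℕ) ≠ j := fun h => hne (by rw [Fin.ext h])
      refine (map_sum_real_ghost φ (a := ⟨v, i⟩) (d := ⟨v, j⟩) rfl).symm.trans ((h _ _
        (.real_ghost v (isRegular_of_vertexWeight_pos i.pos) i j i.2 j.2)).trans ?_)
      rw [if_neg hij, map_zero]
    · have hef : e ≠ f := fun h => hne (congrArg Sum.inr h)
      have hsrc := ha.trans hd.symm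
      refine (map_sum_ghost_real φ hsrc).symm.trans ((h _ _ (.ghost_real _ ⟨e, rfl⟩ e f rfl
        hsrc.symm)).trans ?_)
      rw [if_neg hef, map_zero]

theorem eq_of_leavittRel
    (h : c.pattern.IsRealization (fun v => φ (gen K (.inl v))) (entryMap φ))
    {a b : FreeNUAlgebra K G.Letter} (hab : G.LeavittRel K a b) : φ a = φ b := by
  rcases hab with hab | ⟨v, hv, i, j, hi, hj⟩ | ⟨v, hv, e, f, he, hf⟩
  · rcases hab with ⟨u, v⟩ | x | x
    · rw [map_mul]
      split_ifs with huv
      · rw [← huv, h.vertex_mul_self]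
      · rw [h.vertex_mul_of_ne huv, map_zero]
    · rw [map_mul, ← entryMap_toEntry, ← vtx_toEntry_fst c, h.vertex_mul]
    · rw [map_mul, ← entryMap_toEntry, ← vtx_toEntry_snd c, h.mul_vertex]
  · rw [map_sum_real_ghost φ (a := ⟨v, i, hi⟩) (d := ⟨v, j, hj⟩) rfl]
    obtain ⟨e, rfl⟩ := hv
    split_ifs with hij
    · subst hij
      exact h.sum_mul_self (.inl ⟨_, i, hi⟩)
    · rw [map_zero]
      exact h.sum_mul_of_ne (b := .inr e) (inr_mem_crossing.2 rfl) (inr_mem_crossing.2 rfl)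
        (by simpa using hij)
  · subst he
    rw [map_sum_ghost_real φ hf.symm]
    split_ifs with hef
    · subst hef
      exact h.sum_mul_self (.inr e)
    · rw [map_zero]
      exact h.sum_mul_of_ne (b := row G ⟨e, 0, G.weight_pos e⟩) (inl_mem_crossing.2 rfl)
        (inl_mem_crossing.2 hf) (by simpa using hef)

end Realization

variable (K : Type*) [Field K]

/-- The homomorphism from the free algebra to the operators on the space of reduced words. -/
noncomputable def opHom : FreeNUAlgebra K G.Letter →ₙₐ[K] Module.End K (c.pattern.WordSpace K) :=
  lift (K := K) (X := G.Letter) (B := Module.End K (c.pattern.WordSpace K))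
    (Sum.elim (vertexOp K) fun x => entryOp K (G.toEntry x))

theorem entryMap_opHom (a b : G.Index) :
    entryMap (K := K) (A := Module.End K (c.pattern.WordSpace K)) (opHom c K) a b =
      entryOp K (a, b) := by
  by_cases hab : (a, b) ∈ Set.range G.toEntry
  · obtain ⟨x, hx⟩ := hab
    obtain ⟨rfl, rfl⟩ : (G.toEntry x).1 = a ∧ (G.toEntry x).2 = b := Prod.ext_iff.1 hx
    rw [entryMap_toEntry, opHom, lift_gen]
    rfl
  · rw [entryMap_eq_zero _ hab, entryOp_eq_zero hab]

theorem opHom_eq_of_leavittRel (a b : FreeNUAlgebra K G.Letter) (hab : G.LeavittRel K a b) :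
    opHom c K a = opHom c K b := by
  refine eq_of_leavittRel c ?_ hab
  convert isRealization_entryOp (S := c.pattern) (K := K) using 1
  · funext v
    exact lift_gen _ _
  · funext a b
    exact entryMap_opHom c K a b

theorem wordMap_mkHom_injective [Finite V] :
    Function.Injective (wordMap c.pattern K
      (fun v => AlgQuot.mkHom K (G.LeavittRel K) (gen K (.inl v)))
      (entryMap (AlgQuot.mkHom K (G.LeavittRel K)))) := by
  let Φ := AlgQuot.lift (B := Module.End K (c.pattern.WordSpace K)) (opHom c K)
    (opHom_eq_of_leavittRel c K)
  exact wordMap_injective (φ := Φ) (fun u => lift_gen _ _) fun a b =>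
    (map_entryMap _ Φ a b).trans (entryMap_opHom c K a b)

theorem adjoin_range_entryMap_mkHom :
    NonUnitalAlgebra.adjoin K
      ((Set.range fun v => AlgQuot.mkHom K (G.LeavittRel K) (gen K (.inl v))) ∪
        Set.range (Function.uncurry (entryMap (AlgQuot.mkHom K (G.LeavittRel K))))) = ⊤ := by
  rw [eq_top_iff, ← AlgQuot.adjoin_range_mkHom_gen]
  refine NonUnitalAlgebra.adjoin_mono ?_
  rintro _ ⟨v | x, rfl⟩
  · exact .inl ⟨v, rfl⟩
  · exact .inr ⟨G.toEntry x, entryMap_toEntry _ x⟩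

theorem exists_isGeneratingSpace_growthFun_eq [Finite V] :
    ∃ W : Submodule K (G.LeavittPathAlgebra K), IsGeneratingSpace W ∧
      ∀ n, 1 ≤ n → growthFun W n = (c.pattern.reducedWords n).ncard := by
  have hrel := isRealization_entryMap c fun _ _ => AlgQuot.mkHom_eq_of_rel (K := K)
  exact ⟨_, hrel.isGeneratingSpace_wordSpan (adjoin_range_entryMap_mkHom K),
    fun n hn => hrel.growthFun_wordSpan (wordMap_mkHom_injective c K) hn⟩

end WeightedGraph

/-! ### Nod-paths as walks -/

namespace WeightedGraph

open MatrixPattern RelWalk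

variable {V E : Type*}

theorem pathLength_map {α β : Type*} (l : List β) :
    pathLength (l.map (Sum.inr : β → α ⊕ β)) = l.length := by
  rw [pathLength, List.countP_map, List.countP_eq_length]
  simp

theorem isRotated_map_iff {α β : Type*} {f : α → β} (hf : Function.Injective f) {l m : List α} :
    (l.map f).IsRotated (m.map f) ↔ l.IsRotated m := by
  refine ⟨fun ⟨n, hn⟩ => ⟨n, ?_⟩, fun h => h.map f⟩
  rw [← List.map_rotate] at hn
  exact hf.list_map hn

variable [Fintype E] {G : WeightedGraph V E} (c : G.SpecialEdges)

/-- Two edges of the double graph that may follow each other in a nod-path. -/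
def NodRel (x y : G.DEdge) : Prop :=
  G.hat.double.rng x = G.hat.double.src y ∧ ¬ Forbidden c [Sum.inr x, Sum.inr y]

theorem forbidden_iff {q : List G.Letter} :
    Forbidden c q ↔
      ∃ x y, q = [Sum.inr x, Sum.inr y] ∧ c.pattern.Clash (G.toEntry x) (G.toEntry y) := by
  constructor
  · rintro (⟨v, hv, i, j⟩ | ⟨e, f, h⟩)
    · have hedge : ∀ w hw, w = v → c.edge v hv = c.edge w hw := by
        rintro _ _ rfl
        rfl
      exact ⟨_, _, rfl, rfl, congrArg Sum.inr (hedge _ _ (c.src_edge v hv))⟩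
    · exact ⟨_, _, rfl, row_eq_row_iff.2 ⟨h, rfl⟩, rfl⟩
  · rintro ⟨⟨e, i⟩ | ⟨e, i⟩, ⟨f, j⟩ | ⟨f, j⟩, rfl, hmeet, hpivot⟩
    · exact absurd hmeet Sum.inr_ne_inl
    · obtain rfl : e = f := Sum.inr_injective hmeet
      have hforbidden : ∀ v hv, e = c.edge v hv → Forbidden c
          [Sum.inr (Sum.inl ⟨e, i⟩), Sum.inr (Sum.inr ⟨e, j⟩)] := by
        rintro v hv rfl
        exact .real_ghost v hv i j
      exact hforbidden _ _ (Sum.inr_injective hpivot)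
    · have hi := (row_eq_row_iff.1 hpivot).2
      obtain ⟨hsrc, hij⟩ := row_eq_row_iff.1 hmeet
      obtain rfl : i = ⟨0, G.weight_pos e⟩ := Fin.ext hi
      obtain rfl : j = ⟨0, G.weight_pos f⟩ := Fin.ext hij.symm
      exact .ghost_real e f hsrc
    · exact absurd hmeet Sum.inl_ne_inr

theorem forbidden_pair_iff {x y : G.DEdge} :
    Forbidden c [Sum.inr x, Sum.inr y] ↔ c.pattern.Clash (G.toEntry x) (G.toEntry y) := by
  rw [forbidden_iff]
  constructor
  · rintro ⟨x', y', h, hcl⟩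
    simp only [List.cons.injEq, Sum.inr.injEq, and_true] at h
    rwa [h.1, h.2]
  · exact fun h => ⟨x, y, rfl, h⟩

theorem reduced_map_toEntry_iff {l : List G.DEdge} {v : V} :
    c.pattern.Reduced (l.map G.toEntry) v ↔
      l.IsChain (NodRel c) ∧ ∀ x ∈ l.getLast?, G.hat.double.rng x = v := by
  have hadj (x : G.DEdge) : c.pattern.Adj (G.toEntry x).1 (G.toEntry x).2 := ⟨x, rfl⟩
  induction l with
  | nil => simp [Reduced]
  | cons x l ih =>
    simp only [List.map_cons, Reduced, ih]
    cases l with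
    | nil => simp [hadj, vtx_toEntry_snd, wordSrc]
    | cons y l =>
      rw [List.isChain_cons_cons, List.getLast?_cons_cons, NodRel, forbidden_pair_iff]
      simp only [hadj, vtx_toEntry_snd, vtx_toEntry_fst, wordSrc, List.map_cons, List.head?_cons,
        Option.mem_def, Option.some.injEq, forall_eq', true_and]
      tauto

theorem exists_map_toEntry_eq {l : List (G.Index × G.Index)} {v : V}
    (h : c.pattern.Reduced l v) : ∃ l', List.map G.toEntry l' = l := by
  induction l with
  | nil => exact ⟨[], rfl⟩
  | cons y l ih =>
    obtain ⟨l, rfl⟩ := ih h.2.2.2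
    obtain ⟨x, hx⟩ := h.1
    exact ⟨x :: l, congrArg (· :: _) hx⟩

theorem isNodPath_map_iff {l : List G.DEdge} (hl : l ≠ []) :
    IsNodPath c (l.map Sum.inr) ↔ l.IsChain (NodRel c) := by
  constructor
  · rintro ⟨hp, hq⟩
    have hch : l.IsChain (fun x y => G.hat.double.rng x = G.hat.double.src y) := by
      rcases hp with ⟨v, hv⟩ | ⟨l', -, h, he⟩
      · obtain ⟨x, l, rfl⟩ := List.exists_cons_of_ne_nil hl
        simp at hv
      · rwa [Sum.inr_injective.list_map he]
    rw [List.isChain_iff_forall_rel_of_append_cons_cons] at hch ⊢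
    intro a b l₁ l₂ he
    exact ⟨hch he, hq _ ⟨l₁.map Sum.inr, l₂.map Sum.inr, by rw [he]; simp⟩⟩
  · intro h
    refine ⟨.inr ⟨l, hl, h.imp fun _ _ => And.left, rfl⟩, fun q hq hf => ?_⟩
    obtain ⟨q, hq', rfl⟩ := List.infix_map_iff.1 hq
    obtain ⟨x, y, he, -⟩ := (forbidden_iff c).1 hf
    obtain rfl : q = [x, y] := Sum.inr_injective.list_map he
    exact (List.isChain_pair.1 (h.infix hq')).2 hf

theorem IsNodPath.exists_map {p q : List G.Letter} (h : IsNodPath c (p ++ q)) (hp : p ≠ [])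
    (hq : q ≠ []) :
    ∃ l m : List G.DEdge, p = l.map Sum.inr ∧ q = m.map Sum.inr ∧ l ≠ [] ∧ m ≠ [] := by
  rcases h.1 with ⟨v, hv⟩ | ⟨l, -, -, he⟩
  · rcases List.append_eq_singleton_iff.1 hv with h | h
    exacts [absurd h.1 hp, absurd h.2 hq]
  · obtain ⟨l₁, l₂, rfl, rfl, rfl⟩ := List.map_eq_append_iff.1 he.symm
    exact ⟨l₁, l₂, rfl, rfl, by simpa using hp, by simpa using hq⟩

variable {c} in
theorem IsNodPath.ne_nil {p : List G.Letter} (h : IsNodPath c p) : p ≠ [] := by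
  rintro rfl
  rcases h.1 with ⟨v, hv⟩ | ⟨l, hl, -, he⟩
  · exact List.cons_ne_nil _ _ hv.symm
  · exact hl (List.map_eq_nil_iff.1 he.symm)

theorem isNodSqPath_iff {p : List G.Letter} :
    IsNodSqPath c p ↔ ∃ l, p = l.map Sum.inr ∧ IsClosed (NodRel c) l := by
  constructor
  · rintro ⟨h1, h2⟩
    obtain ⟨l, -, rfl, -, hl, -⟩ := h2.exists_map c h1.ne_nil h1.ne_nil
    rw [← List.map_append, isNodPath_map_iff c (by simp [hl])] at h2
    exact ⟨l, rfl, hl, h2⟩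
  · rintro ⟨l, rfl, hl, h⟩
    refine ⟨(isNodPath_map_iff c hl).2 h.left_of_append, ?_⟩
    rw [← List.map_append]
    exact (isNodPath_map_iff c (by simp [hl])).2 h

theorem isQuasiCycle_map_iff {l : List G.DEdge} :
    IsQuasiCycle c (l.map Sum.inr) ↔ IsMinimalClosed (NodRel c) l := by
  have hsq : ∀ l : List G.DEdge, IsNodSqPath c (l.map Sum.inr) ↔ IsClosed (NodRel c) l := by
    intro l
    rw [isNodSqPath_iff]
    constructor
    · rintro ⟨l', he, h⟩
      rwa [Sum.inr_injective.list_map he]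
    · exact fun h => ⟨l, rfl, h⟩
  unfold IsQuasiCycle IsMinimalClosed
  rw [hsq, ← List.map_append, pathLength_map]
  refine and_congr_right fun _ => ⟨fun h q hq hlt hcl => ?_, fun h q hq hlt hcl => ?_⟩
  · exact h (q.map Sum.inr) (List.infix_map_iff.2 ⟨q, hq, rfl⟩) (by rwa [pathLength_map])
      ((hsq q).2 hcl)
  · obtain ⟨q, hq', rfl⟩ := List.infix_map_iff.1 hq
    rw [pathLength_map] at hlt
    exact h q hq' hlt ((hsq q).1 hcl)

theorem IsQuasiCycle.exists_map {p : List G.Letter} (h : IsQuasiCycle c p) :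
    ∃ l : List G.DEdge, p = l.map Sum.inr ∧ IsMinimalClosed (NodRel c) l := by
  obtain ⟨l, rfl, -⟩ := (isNodSqPath_iff c).1 h.1
  exact ⟨l, rfl, (isQuasiCycle_map_iff c).1 h⟩

theorem nodConnects_map_iff {l m : List G.DEdge} (hl : l ≠ []) (hm : m ≠ []) :
    NodConnects c (l.map Sum.inr) (m.map Sum.inr) ↔ Links (NodRel c) l m := by
  constructor
  · rintro ⟨o, ho, hpo, h⟩
    have h' := h
    rw [List.append_assoc] at h'
    obtain ⟨-, t, -, ht, -⟩ := h'.exists_map c (by simpa using hl) (by simp [hm])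
    obtain ⟨o, -, -, rfl, -⟩ := List.map_eq_append_iff.1 ht.symm
    rw [← List.map_append, ← List.map_append, isNodPath_map_iff c (by simp [hl])] at h
    rw [List.prefix_map_iff_of_injective Sum.inr_injective] at hpo
    exact ⟨o, by simpa using ho.ne_nil, hpo, h⟩
  · rintro ⟨o, ho, hpo, h⟩
    refine ⟨o.map Sum.inr, (isNodPath_map_iff c ho).2 h.left_of_append.right_of_append, ?_, ?_⟩
    · rwa [List.prefix_map_iff_of_injective Sum.inr_injective]
    · rw [← List.map_append, ← List.map_append]
      exact (isNodPath_map_iff c (by simp [hl])).2 h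

theorem noSelfLink_iff : NoSelfLink (NodRel c) ↔ ¬ ∃ p, IsSelfconnected c p := by
  constructor
  · rintro h ⟨p, hp, hpp⟩
    obtain ⟨l, rfl, hl⟩ := hp.exists_map
    exact h l hl ((nodConnects_map_iff c hl.1.1 hl.1.1).1 hpp)
  · exact fun h l hl hll => h ⟨l.map Sum.inr, (isQuasiCycle_map_iff c).2 hl,
      (nodConnects_map_iff c hl.1.1 hl.1.1).2 hll⟩

theorem isQuasiCycleChain_map_iff {L : List (List G.DEdge)} :
    IsQuasiCycleChain c (L.map (List.map Sum.inr)) ↔ IsMinimalClosedChain (NodRel c) L := by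
  unfold IsQuasiCycleChain IsMinimalClosedChain
  rw [List.forall_mem_map, List.pairwise_map, List.isChain_map]
  simp only [isQuasiCycle_map_iff, isRotated_map_iff (Sum.inr_injective (α := V) (β := G.DEdge))]
  refine and_congr_right fun hL => and_congr_right fun _ => List.IsChain.iff_of_mem_imp ?_
  intro p q hp hq
  have hp0 := (hL p hp).1.1
  have hq0 := (hL q hq).1.1
  rw [Connects, nodConnects_map_iff c hp0 hq0, ← List.map_append,
    isNodPath_map_iff c (by simp [hp0])]

theorem exists_isQuasiCycleChain_iff {k : ℕ} :
    (∃ L, IsQuasiCycleChain c L ∧ L.length = k) ↔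
      ∃ L, IsMinimalClosedChain (NodRel c) L ∧ L.length = k := by
  constructor
  · rintro ⟨L, hL, rfl⟩
    have hex : ∃ L' : List (List G.DEdge), L'.map (List.map Sum.inr) = L := by
      have h := hL.1
      clear hL
      induction L with
      | nil => exact ⟨[], rfl⟩
      | cons p L ih =>
        obtain ⟨L', rfl⟩ := ih fun q hq => h q (List.mem_cons_of_mem _ hq)
        obtain ⟨l, rfl, -⟩ := (h p (by simp)).exists_map
        exact ⟨l :: L', rfl⟩
    obtain ⟨L', rfl⟩ := hex
    exact ⟨L', (isQuasiCycleChain_map_iff c).1 hL, by simp⟩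
  · rintro ⟨L, hL, rfl⟩
    exact ⟨_, (isQuasiCycleChain_map_iff c).2 hL, by simp⟩

theorem ncard_walks_le_ncard_reducedWords [Finite V] [Nonempty V] (n : ℕ) :
    (walks (NodRel c) n).ncard ≤ (c.pattern.reducedWords n).ncard := by
  refine Set.ncard_le_ncard_of_injOn (fun l => (l.map G.toEntry,
    (l.getLast?.map G.hat.double.rng).getD (Classical.arbitrary V))) ?_ ?_ (finite_reducedWords n)
  · rintro l ⟨hl, hlen⟩
    refine ⟨(reduced_map_toEntry_iff c).2 ⟨hl, fun x hx => ?_⟩, by rwa [List.length_map]⟩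
    rw [Option.mem_def.1 hx]
    rfl
  · exact fun l _ m _ h => toEntry_injective.list_map (congrArg Prod.fst h)

theorem ncard_reducedWords_le [Finite V] (n : ℕ) :
    (c.pattern.reducedWords n).ncard ≤ (walks (NodRel c) n).ncard * Nat.card V := by
  have hsub : c.pattern.reducedWords n ⊆
      Prod.map (List.map G.toEntry) id '' (walks (NodRel c) n ×ˢ Set.univ) := by
    rintro ⟨l, v⟩ ⟨h, hlen⟩
    obtain ⟨l, rfl⟩ := exists_map_toEntry_eq c h
    exact ⟨(l, v), ⟨⟨((reduced_map_toEntry_iff c).1 h).1, by rwa [List.length_map] at hlen⟩,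
      trivial⟩, rfl⟩
  have hfin := (finite_walks (R := NodRel c) n).prod (Set.finite_univ (α := V))
  calc (c.pattern.reducedWords n).ncard
      ≤ (Prod.map (List.map G.toEntry) id '' (walks (NodRel c) n ×ˢ Set.univ)).ncard :=
        Set.ncard_le_ncard hsub (hfin.image _)
    _ ≤ (walks (NodRel c) n ×ˢ (Set.univ : Set V)).ncard := Set.ncard_image_le hfin
    _ = (walks (NodRel c) n).ncard * Nat.card V := by rw [Set.ncard_prod, Set.ncard_univ]

theorem exists_isGeneratingSpace_growthFun_bounds (K : Type*) [Field K] [Finite V] [Nonempty V] :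
    ∃ W : Submodule K (G.LeavittPathAlgebra K), IsGeneratingSpace W ∧
      ∀ n, 1 ≤ n → (walks (NodRel c) n).ncard ≤ growthFun W n ∧
        growthFun W n ≤ (walks (NodRel c) n).ncard * Nat.card V := by
  obtain ⟨W, hW, hgrowth⟩ := exists_isGeneratingSpace_growthFun_eq c K
  refine ⟨W, hW, fun n hn => ?_⟩
  rw [hgrowth n hn]
  exact ⟨ncard_walks_le_ncard_reducedWords c n, ncard_reducedWords_le c n⟩

/-! ### Growth of weighted Leavitt path algebras -/

variable {K : Type*} [Field K] [Finite V] [Nonempty V]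

theorem noSelfLink_of_hasPolynomialGrowth (h : HasPolynomialGrowth K (G.LeavittPathAlgebra K)) :
    NoSelfLink (NodRel c) := by
  intro p hp hpp
  obtain ⟨W, hW, hgrowth⟩ := exists_isGeneratingSpace_growthFun_bounds c K
  obtain ⟨m, hm, hpow⟩ := hp.exists_two_pow_le_ncard_walks hpp
  have := hW.1
  refine not_hasPolynomialGrowth_of_two_pow_le (V := W) hm (fun n => ?_) h
  calc 2 ^ n ≤ 2 ^ (n + 1) := Nat.pow_le_pow_right two_pos n.le_succ
    _ ≤ (walks (NodRel c) (m * (n + 1))).ncard := hpow (n + 1)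
    _ ≤ growthFun W (m * (n + 1)) := (hgrowth _ (Nat.mul_pos hm n.succ_pos)).1

variable (K) in
theorem exists_growthFun_bounds_of_isGreatest (hR : NoSelfLink (NodRel c)) {d : ℕ}
    (hd : IsGreatest {k | ∃ L, IsMinimalClosedChain (NodRel c) L ∧ L.length = k} d) :
    ∃ W : Submodule K (G.LeavittPathAlgebra K), IsGeneratingSpace W ∧ ∃ a b, 1 ≤ a ∧ 1 ≤ b ∧
      (∀ m, 1 ≤ m → m ^ d ≤ growthFun W (a * m)) ∧ ∀ n, 1 ≤ n → growthFun W n ≤ b * n ^ d := by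
  obtain ⟨W, hW, hgrowth⟩ := exists_isGeneratingSpace_growthFun_bounds c K
  obtain ⟨B, hB, hup⟩ := hR.exists_ncard_walks_le fun L hL => hd.2 ⟨L, hL, rfl⟩
  obtain ⟨L, hL, rfl⟩ := hd.1
  obtain ⟨a, ha, hlow⟩ := hR.exists_pow_le_ncard_walks hL
  refine ⟨W, hW, a, B * Nat.card V, ha, Nat.mul_pos hB Nat.card_pos,
    fun m hm => (hlow m hm).trans (hgrowth _ (Nat.mul_pos ha hm)).1, fun n hn => ?_⟩
  calc growthFun W n ≤ (walks (NodRel c) n).ncard * Nat.card V := (hgrowth n hn).2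
    _ ≤ B * n ^ L.length * Nat.card V := Nat.mul_le_mul_right _ (hup n hn)
    _ = B * Nat.card V * n ^ L.length := mul_right_comm ..

end WeightedGraph

theorem mainTheorem1 {K V E : Type*} [Field K] [Finite V] [Nonempty V] [Fintype E]
    (G : WeightedGraph V E) (c : G.SpecialEdges) :
    (HasPolynomialGrowth K (G.LeavittPathAlgebra K) ↔
      ¬ ∃ p, WeightedGraph.IsSelfconnected c p) ∧
    (HasPolynomialGrowth K (G.LeavittPathAlgebra K) →
      ∃ d : ℕ, IsGreatest {k | ∃ L, WeightedGraph.IsQuasiCycleChain c L ∧ L.length = k} d ∧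
        IsGKDim K (G.LeavittPathAlgebra K) d) := by
  simp only [← WeightedGraph.noSelfLink_iff, WeightedGraph.exists_isQuasiCycleChain_iff]
  refine ⟨⟨WeightedGraph.noSelfLink_of_hasPolynomialGrowth c, fun hR => ?_⟩, fun hpoly => ?_⟩
  · obtain ⟨d, hd⟩ := hR.exists_isGreatest_length
    obtain ⟨W, hW, -, b, -, -, -, hup⟩ :=
      WeightedGraph.exists_growthFun_bounds_of_isGreatest c K hR hd
    exact hasPolynomialGrowth_of_growthFun_le hW hup
  · have hR := WeightedGraph.noSelfLink_of_hasPolynomialGrowth c hpoly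
    obtain ⟨d, hd⟩ := hR.exists_isGreatest_length
    obtain ⟨W, hW, a, b, ha, hb, hlow, hup⟩ :=
      WeightedGraph.exists_growthFun_bounds_of_isGreatest c K hR hd
    exact ⟨d, hd, isGKDim_of_growthFun_bounds hW ha hb hlow hup⟩
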